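/- Let $K$ be a non-archimedean local field of characteristic $0$ with finite residue field, let $\bar K$ be an algebraic closure of $K$, $G=\mathrm{Gal}(\bar K/K)$, and let $K_{ur}\subset\bar K$ be the maximal unramified extension of $K$. Let $\mathfrak w\subset \mathrm{Gal}(K_{ur}/K)$ be the subgroup of integral powers of the Frobenius automorphism. The Weil group $W$ of $K$ is the preimage of $\mathfrak w$ under $G\to\mathrm{Gal}(K_{ur}/K)$, with the group topology for which the inertia group $I=\mathrm{Gal}(\bar K/K_{ur})$, with its profinite topology, is an open subgroup. A discrete $G$-module $M$ is an abelian group with the discrete topology and a continuous action of $G$; it is also a $W$-module through $W\to G$. Write $H^i(G,M)$ and $H^i(W,M)$ for the cohomology groups defined by continuous cochains. Let $M$ be a discrete $G$-module. The restriction maps $\mathrm{res}^i\colon H^i(G,M)\to H^i(W,M)$, which are functorial in $M$, have the following properties. (i) $\mathrm{res}^0\colon H^0(G,M)\to H^0(W,M)$ is an isomorphism. (ii) $\mathrm{res}^1$ is injective and its image is the torsion subgroup of $H^1(W,M)$, so that $H^1(G,M)\cong H^1(W,M)_{\mathrm{tors}}$. (iii) There is a short exact sequence, functorial in $M$, $$0\to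 H^1(W,M)\otimes_{\mathbf Z}\mathbf Q/\mathbf Z\to H^2(G,M)\xrightarrow{\ \mathrm{res}^2\ }H^2(W,M)\to 0.$$ (iv) $\mathrm{res}^i\colon H^i(G,M)\to H^i(W,M)$ is an isomorphism for all $i\ge 3$. -/

import Mathlib

open ValuativeRel TensorProduct CategoryTheory

universe u v w

noncomputable section

/-! ### The Weil group of a local field -/

section WeilGroup

variable (K : Type u) [Field K] [ValuativeRel K] (Kbar : Type v) [Field Kbar] [Algebra K Kbar]

/-- An intermediate field `E` of `Kbar / K` is a finite unramified extension of `K` if it is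
finite over `K` and its ring of integers is unramified over the ring of integers of `K`. -/
def IsFiniteUnramified (E : IntermediateField K Kbar) : Prop :=
  FiniteDimensional K E ∧ Algebra.FormallyUnramified 𝒪[K] (integralClosure 𝒪[K] E)

/-- The maximal unramified extension `K_ur` of `K` inside `Kbar`: the compositum of all finite
unramified extensions of `K` contained in `Kbar`. -/
def maximalUnramified : IntermediateField K Kbar :=
  ⨆ E : {E : IntermediateField K Kbar // IsFiniteUnramified K Kbar E}, E.1

variable {K Kbar} in
theorem IsFiniteUnramified.map {E : IntermediateField K Kbar} (hE : IsFiniteUnramified K Kbar E)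
    (σ : Kbar →ₐ[K] Kbar) : IsFiniteUnramified K Kbar (E.map σ) := by
  obtain ⟨h₁, h₂⟩ := hE
  let e : E ≃ₐ[K] E.map σ := IntermediateField.equivMap E σ
  exact ⟨e.toLinearEquiv.finiteDimensional,
    .of_equiv ((e.restrictScalars 𝒪[K]).mapIntegralClosure)⟩

instance normal_maximalUnramified [IsAlgClosure K Kbar] :
    Normal K (maximalUnramified K Kbar) := by
  have : Normal K Kbar := IsAlgClosure.normal K Kbar
  rw [IntermediateField.normal_iff_forall_map_le]
  intro σ
  rw [maximalUnramified, IntermediateField.map_iSup]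
  exact iSup_le fun E => le_iSup
    (fun E : {E : IntermediateField K Kbar // IsFiniteUnramified K Kbar E} => E.1)
    ⟨E.1.map σ, E.2.map σ⟩

variable [IsAlgClosure K Kbar]

/-- The quotient map `Gal(Kbar/K) → Gal(K_ur/K)`. -/
def galToUnramified : Gal(Kbar/K) →* Gal(maximalUnramified K Kbar/K) :=
  AlgEquiv.restrictNormalHom (maximalUnramified K Kbar)

variable {K Kbar} in
/-- `φ ∈ Gal(K_ur/K)` is the Frobenius automorphism if it induces the map `x ↦ x ^ q` on the
residue field of the ring of integers of `K_ur`, where `q` is the cardinality of the residue field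
of `K`. -/
def IsUnramifiedFrobenius (φ : Gal(maximalUnramified K Kbar/K)) : Prop :=
  ∀ Q : Ideal (integralClosure 𝒪[K] (maximalUnramified K Kbar)), Q.IsMaximal →
    (φ.restrictScalars 𝒪[K]).mapIntegralClosure.toAlgHom.IsArithFrobAt Q

/-- The subgroup `𝔴` of `Gal(K_ur/K)` consisting of the integral powers of the Frobenius. -/
def frobeniusPowers : Subgroup Gal(maximalUnramified K Kbar/K) :=
  Subgroup.closure {φ | IsUnramifiedFrobenius φ}

/-- The Weil group `W` of `K`: the pullback of `𝔴` under `Gal(Kbar/K) → Gal(K_ur/K)`. -/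
def WeilGroup : Type v := ↥((frobeniusPowers K Kbar).comap (galToUnramified K Kbar))

instance : Group (WeilGroup K Kbar) :=
  inferInstanceAs (Group ↥((frobeniusPowers K Kbar).comap (galToUnramified K Kbar)))

namespace WeilGroup

/-- The inclusion `W → G`. -/
def toGal : WeilGroup K Kbar →* Gal(Kbar/K) :=
  ((frobeniusPowers K Kbar).comap (galToUnramified K Kbar)).subtype

/-- The projection `W → 𝔴`. -/
def toFrobeniusPowers : WeilGroup K Kbar →* frobeniusPowers K Kbar :=
  (galToUnramified K Kbar).subgroupComap (frobeniusPowers K Kbar)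

/-- The topology of `W` as the fibre product of the profinite group `G` and the discrete group `𝔴`:
it is the group topology for which the inertia group `I = ker (W → 𝔴)`, with its
topology as a subgroup of `G`, is an open topological subgroup. -/
instance : TopologicalSpace (WeilGroup K Kbar) :=
  TopologicalSpace.induced (toGal K Kbar) (krullTopology K Kbar) ⊓
    TopologicalSpace.induced (toFrobeniusPowers K Kbar) ⊥

instance : IsTopologicalGroup (WeilGroup K Kbar) := by
  have h₁ := topologicalGroup_induced (toGal K Kbar)
  let _ : TopologicalSpace (frobeniusPowers K Kbar) := ⊥
  have _ : DiscreteTopology (frobeniusPowers K Kbar) := ⟨rfl⟩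
  have h₂ := topologicalGroup_induced (toFrobeniusPowers K Kbar)
  exact topologicalGroup_inf h₁ h₂

/-- The inclusion `W → G` as a continuous homomorphism. -/
def toGalCont : WeilGroup K Kbar →ₜ* Gal(Kbar/K) where
  toMonoidHom := toGal K Kbar
  continuous_toFun := continuous_iff_le_induced.2 inf_le_left

end WeilGroup

end WeilGroup

/-! ### Cohomology of discrete modules -/

section Cohomology

variable {Γ Δ : Type v} [Group Γ] [TopologicalSpace Γ] [IsTopologicalGroup Γ]
  [Group Δ] [TopologicalSpace Δ] [IsTopologicalGroup Δ]

/-- A `Γ`-module is discrete if it has the discrete topology and the action `Γ × M → M` is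
continuous. -/
def IsDiscreteModule (M : TopRep.{max v w} ℤ Γ) : Prop :=
  DiscreteTopology M ∧ Continuous fun p : Γ × M => M.ρ p.1 p.2

/-- The cohomology group `H^n(Γ, M)` (cohomology of the complex of continuous cochains). -/
def Coh (n : ℕ) (M : TopRep.{max v w} ℤ Γ) : Type (max v w) :=
  continuousCohomology.{0, v, w} n M

instance (n : ℕ) (M : TopRep.{max v w} ℤ Γ) : AddCommGroup (Coh.{v, w} n M) :=
  inferInstanceAs (AddCommGroup (continuousCohomology.{0, v, w} n M))

namespace Coh

/-- The homomorphism `H^n(Γ, M) → H^n(Γ, N)` induced by a homomorphism `M → N` of `Γ`-modules. -/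
def map (n : ℕ) {M N : TopRep.{max v w} ℤ Γ} (f : M ⟶ N) : Coh.{v, w} n M →+ Coh.{v, w} n N :=
  (ContinuousCohomology.map.{0, v, w} (ContinuousMonoidHom.id Γ) f n).hom.toLinearMap.toAddMonoidHom

/-- The restriction homomorphism `H^n(Γ, M) → H^n(Δ, M)` along a continuous homomorphism
`φ : Δ → Γ`, where `Δ` acts on `M` through `φ`. -/
def res (φ : Δ →ₜ* Γ) (n : ℕ) (M : TopRep.{max v w} ℤ Γ) :
    Coh.{v, w} n M →+ Coh.{v, w} n (TopRep.res (φ : Δ →* Γ) M) :=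
  (ContinuousCohomology.map.{0, v, w} φ (𝟙 _) n).hom.toLinearMap.toAddMonoidHom

end Coh

end Cohomology

/-- A discrete `G`-module `M` viewed as a `W`-module through `W → G`, as a functor of `M`. -/
abbrev weilRes (K : Type u) [Field K] [ValuativeRel K] (Kbar : Type v) [Field Kbar] [Algebra K Kbar]
    [IsAlgClosure K Kbar] : TopRep.{max v w} ℤ Gal(Kbar/K) ⥤ TopRep.{max v w} ℤ (WeilGroup K Kbar) :=
  TopRep.resFunctor (WeilGroup.toGalCont K Kbar : WeilGroup K Kbar →* Gal(Kbar/K))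

/-- The restriction homomorphism `H^n(G, M) → H^n(W, M)`. -/
def galoisToWeil (K : Type u) [Field K] [ValuativeRel K] (Kbar : Type v) [Field Kbar]
    [Algebra K Kbar] [IsAlgClosure K Kbar] (n : ℕ) (M : TopRep.{max v w} ℤ Gal(Kbar/K)) :
    Coh.{v, w} n M →+ Coh.{v, w} n ((weilRes K Kbar).obj M) :=
  Coh.res (WeilGroup.toGalCont K Kbar) n M

end

/-!
Choose an element `F` of `W` over the Frobenius. It generates `Gal(K_ur/K)` topologically and acts
on the roots of unity of order `q ^ m - 1` through `ℤ/m`, so `Gal(K_ur/K)` is the profinite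
completion of `ℤ` and the extension `G → Gal(K_ur/K)` has a continuous splitting which on the
powers of the Frobenius is `n ↦ F ^ n`.

Every discrete module embeds into the acyclic module `C(G, M)` of continuous functions on `G`, with
discrete quotient `shift M`, so everything is reduced to low degrees by dimension shifting once the
cohomology of `W` in `C(G, M)` is known. For a `W`-module `X` the difference operator gives an exact
sequence `0 → X → (ℤ → X) → (ℤ → X) → 0`, where `ℤ → X` is coinduced from the inertia group. For
`X = C(G, M)` the splitting makes `ℤ → X` acyclic, hence `H^i(W, X) = 0` for `i ≥ 2`, while
`H^1(W, X)` is the group of periodic functions `ℤ → M` modulo differences of periodic functions.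
Up to such differences a periodic function is determined by its sum over a period, and the sum over
`k` times the period is `k` times as large, so `H^1(W, X)` is uniquely divisible.

In the exact sequence `H^1(W, M) → H^1(W, C(G, M)) → H^1(W, shift M) → H^2(W, M) → 0` the second
term is thus a rational vector space, while `H^2(W, M)` is torsion. The torsion of the third term,
which is `H^1(G, shift M) = H^2(G, M)`, is therefore an extension of `H^2(W, M)` by
`H^1(W, M) ⊗ ℚ/ℤ`.
-/

noncomputable section

/-! ### The long exact cohomology sequence -/

namespace Coh

open TopRep ContRepresentation

/-- The functor forgetting topologies, through which homological algebra in an abelian category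
applies to the complexes of continuous cochains. -/
abbrev forgetTopology : TopModuleCat.{u} ℤ ⥤ ModuleCat.{u} ℤ :=
  forget₂ _ _

variable {Γ Δ : Type v} [Group Γ] [TopologicalSpace Γ] [IsTopologicalGroup Γ]
  [Group Δ] [TopologicalSpace Δ] [IsTopologicalGroup Δ]
  {X : TopRep.{max v w} ℤ Γ} {Y : TopRep.{max v w} ℤ Δ}

/-- The complex of abelian groups underlying the complex of homogeneous cochains. -/
def cochains (X : TopRep.{max v w} ℤ Γ) : CochainComplex (ModuleCat.{max v w} ℤ) ℕ :=
  (forgetTopology.{max v w}.mapHomologicalComplex _).obj (homogeneousCochains X)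

/-- The map on complexes of cochains induced by a continuous homomorphism `φ : Δ → Γ` and a morphism
of `Δ`-modules `X → Y`. -/
def cochainsMap (φ : Δ →ₜ* Γ) (f : TopRep.res (φ : Δ →* Γ) X ⟶ Y) :
    cochains.{v, w} X ⟶ cochains.{v, w} Y :=
  (forgetTopology.{max v w}.mapHomologicalComplex _).map (ContinuousCohomology.cochainsMap φ f)

/-- Forgetting topologies commutes with taking cohomology, in the category of abelian groups. -/
def homologyIso (n : ℕ) (X : TopRep.{max v w} ℤ Γ) :
    (cochains.{v, w} X).homology n ≅
      forgetTopology.{max v w}.obj (continuousCohomology.{0, v, w} n X) :=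
  ((homogeneousCochains X).sc n).mapHomologyIso forgetTopology

theorem homologyMap_comp_homologyIso (φ : Δ →ₜ* Γ) (f : TopRep.res (φ : Δ →* Γ) X ⟶ Y) (n : ℕ) :
    HomologicalComplex.homologyMap (cochainsMap.{v, w} φ f) n ≫ (homologyIso.{v, w} n Y).hom =
      (homologyIso.{v, w} n X).hom ≫
        forgetTopology.map (ContinuousCohomology.map.{0, v, w} φ f n) :=
  ShortComplex.mapHomologyIso_hom_naturality
    ((HomologicalComplex.shortComplexFunctor _ _ n).map (ContinuousCohomology.cochainsMap φ f))
    forgetTopology.{max v w}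

/-- The map in cohomology induced by a continuous homomorphism `φ : Δ → Γ` and a morphism of
`Δ`-modules `X → Y`. -/
def pullback (φ : Δ →ₜ* Γ) (f : TopRep.res (φ : Δ →* Γ) X ⟶ Y) (n : ℕ) :
    Coh.{v, w} n X →+ Coh.{v, w} n Y :=
  (ContinuousCohomology.map.{0, v, w} φ f n).hom.toLinearMap.toAddMonoidHom

/-- Forgetting topologies commutes with taking cohomology, on the level of elements. -/
def homologyEquiv (n : ℕ) (X : TopRep.{max v w} ℤ Γ) :
    (cochains.{v, w} X).homology n ≃+ Coh.{v, w} n X :=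
  (homologyIso.{v, w} n X).toLinearEquiv.toAddEquiv

theorem pullback_homologyEquiv (φ : Δ →ₜ* Γ) (f : TopRep.res (φ : Δ →* Γ) X ⟶ Y) (n : ℕ)
    (x : (cochains.{v, w} X).homology n) :
    pullback.{v, w} φ f n (homologyEquiv.{v, w} n X x) =
      homologyEquiv.{v, w} n Y (HomologicalComplex.homologyMap (cochainsMap.{v, w} φ f) n x) :=
  congr($((homologyMap_comp_homologyIso.{v, w} φ f n).symm) x)

variable {Θ : Type v} [Group Θ] [TopologicalSpace Θ] [IsTopologicalGroup Θ]
  {Z : TopRep.{max v w} ℤ Θ}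

theorem cochainsMap_comp (φ : Δ →ₜ* Γ) (ψ : Θ →ₜ* Δ) (f : TopRep.res (φ : Δ →* Γ) X ⟶ Y)
    (g : TopRep.res (ψ : Θ →* Δ) Y ⟶ Z) :
    cochainsMap.{v, w} (X := X) (φ.comp ψ) ((resFunctor (ψ : Θ →* Δ)).map f ≫ g) =
      cochainsMap φ f ≫ cochainsMap ψ g :=
  (congrArg _ (ContinuousCohomology.cochainsMap_comp φ ψ f g)).trans (Functor.map_comp _ _ _)

theorem pullback_pullback (φ : Δ →ₜ* Γ) (ψ : Θ →ₜ* Δ) (f : TopRep.res (φ : Δ →* Γ) X ⟶ Y)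
    (g : TopRep.res (ψ : Θ →* Δ) Y ⟶ Z) (n : ℕ) (x : Coh.{v, w} n X) :
    pullback ψ g n (pullback φ f n x) =
      pullback (X := X) (φ.comp ψ) ((resFunctor (ψ : Θ →* Δ)).map f ≫ g) n x :=
  congr($((ContinuousCohomology.map_comp φ ψ f g n).symm).hom x)

variable {n : ℕ}

/-- The function underlying a homogeneous cochain. -/
def cochainVal (n : ℕ) : (cochains.{v, w} X).X n →+ resolutionX X (n + 1) where
  toFun x := Subtype.val (p := fun F => ∀ g, (resolutionX X (n + 1)).ρ g F = F) x
  map_zero' := rfl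
  map_add' _ _ := rfl

theorem cochainVal_injective : Function.Injective (cochainVal.{v, w} (X := X) n) :=
  Subtype.val_injective

theorem exists_cochainVal_eq_iff {F : resolutionX X (n + 1)} :
    (∃ x, cochainVal.{v, w} n x = F) ↔ ∀ g, (resolutionX X (n + 1)).ρ g F = F :=
  ⟨by rintro ⟨x, rfl⟩ g; exact x.2 g, fun h => ⟨⟨F, h⟩, rfl⟩⟩

theorem cochainVal_d (x : (cochains.{v, w} X).X n) :
    cochainVal (n + 1) ((cochains.{v, w} X).d n (n + 1) x) = d X (n + 1) (cochainVal n x) :=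
  homogeneousCochains.d_apply X n x

/-- The action of `Γ` on a module is jointly continuous. -/
def HasContinuousAction (X : TopRep.{max v w} ℤ Γ) : Prop :=
  Continuous fun p : Γ × X => X.ρ p.1 p.2

theorem HasContinuousAction.resolutionX [LocallyCompactSpace Γ] (hX : HasContinuousAction.{v, w} X)
    (n : ℕ) : HasContinuousAction.{v, w} (resolutionX X n) := by
  induction n with
  | zero => exact hX
  | succ n ih =>
    refine ContinuousMap.continuous_of_continuous_uncurry _ ?_
    have h : Continuous fun q : (Γ × C(Γ, TopRep.resolutionX X n)) × Γ =>
        (q.1.1, q.1.2 (q.1.1⁻¹ * q.2)) := by fun_prop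
    exact ih.comp h

variable {A B C : TopRep.{max v w} ℤ Γ}

/-- A short exact sequence of modules with jointly continuous action that splits as a sequence of
topological spaces. -/
structure TopSplitExact (f : A ⟶ B) (g : B ⟶ C) : Prop where
  continuousAction : HasContinuousAction.{v, w} B
  exists_splitting : ∃ (r : C(B, A)) (s : C(C, B)), (∀ a, r (f a) = a) ∧ (∀ c, g (s c) = c) ∧
    (∀ a, g (f a) = 0) ∧ ∀ b, g b = 0 → f (r b) = b

/-- The map on the terms of the standard resolutions induced by a morphism of modules. -/
abbrev level (f : A ⟶ B) (n : ℕ) : resolutionX A n ⟶ resolutionX B n :=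
  ContinuousCohomology.resolutionMap (ContinuousMonoidHom.id Γ) f n

/-- The map on the homology of cochain complexes induced by a morphism of modules. -/
abbrev homologyMap (f : A ⟶ B) (n : ℕ) :
    (cochains.{v, w} A).homology n ⟶ (cochains.{v, w} B).homology n :=
  HomologicalComplex.homologyMap (cochainsMap (ContinuousMonoidHom.id Γ) f) n

theorem map_homologyEquiv (f : A ⟶ B) (n : ℕ) (x : (cochains.{v, w} A).homology n) :
    map n f (homologyEquiv n A x) = homologyEquiv n B (homologyMap f n x) :=
  pullback_homologyEquiv (ContinuousMonoidHom.id Γ) f n x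

namespace TopSplitExact

variable {f : A ⟶ B} {g : B ⟶ C} (h : TopSplitExact.{v, w} f g)
include h

theorem exists_splitting_level (n : ℕ) :
    ∃ (r : C(resolutionX B n, resolutionX A n)) (s : C(resolutionX C n, resolutionX B n)),
      (∀ a, r (level f n a) = a) ∧ (∀ c, level g n (s c) = c) ∧
      (∀ a, level g n (level f n a) = 0) ∧ ∀ b, level g n b = 0 → level f n (r b) = b := by
  induction n with
  | zero => exact h.exists_splitting
  | succ n ih =>
    obtain ⟨r, s, h₁, h₂, h₃, h₄⟩ := ih
    refine ⟨⟨fun F => r.comp F, r.continuous_postcomp⟩, ⟨fun F => s.comp F, s.continuous_postcomp⟩,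
      fun a => ContinuousMap.ext fun x => h₁ _, fun a => ContinuousMap.ext fun x => h₂ _,
      fun a => ContinuousMap.ext fun x => h₃ _, fun b hb => ContinuousMap.ext fun x => h₄ _ ?_⟩
    exact congr($hb x)

theorem level_injective (n : ℕ) : Function.Injective (level f n) := by
  obtain ⟨r, -, hr, -⟩ := h.exists_splitting_level n
  exact Function.LeftInverse.injective hr

theorem exists_level_eq {n : ℕ} {b : resolutionX B n} (hb : level g n b = 0)
    (hb' : ∀ x, (resolutionX B n).ρ x b = b) :
    ∃ a, level f n a = b ∧ ∀ x, (resolutionX A n).ρ x a = a := by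
  obtain ⟨r, _, _, _, _, hr⟩ := h.exists_splitting_level n
  refine ⟨r b, hr b hb, fun x => h.level_injective n ?_⟩
  rw [hom_comm_apply, hr b hb, hb']

theorem exists_invariant_lift [LocallyCompactSpace Γ] {n : ℕ} {c : resolutionX C (n + 1)}
    (hc : ∀ x, (resolutionX C (n + 1)).ρ x c = c) :
    ∃ b, level g (n + 1) b = c ∧ ∀ x, (resolutionX B (n + 1)).ρ x b = b := by
  obtain ⟨_, s, _, hs, _⟩ := h.exists_splitting_level n
  have hcont : Continuous fun x : Γ => (resolutionX B n).ρ x (s (c 1)) :=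
    (h.continuousAction.resolutionX n).comp (continuous_id.prodMk continuous_const)
  refine ⟨(⟨_, hcont⟩ : C(Γ, resolutionX B n)), ContinuousMap.ext fun x => ?_, fun x =>
    ContinuousMap.ext fun y => ?_⟩
  · have hx : (resolutionX C n).ρ x (c (x⁻¹ * x)) = c x := congr($(hc x) x)
    rw [inv_mul_cancel] at hx
    refine (hom_comm_apply (level g n) x (s (c 1))).trans ?_
    exact (congr_arg _ (hs _)).trans hx
  · change (resolutionX B n).ρ x ((resolutionX B n).ρ (x⁻¹ * y) (s (c 1))) =
      (resolutionX B n).ρ y (s (c 1))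
    rw [← mul_apply_eq_comp, ← map_mul, mul_inv_cancel_left]

omit h in
/-- The short exact sequence of cochain complexes attached to a topologically split sequence. -/
def cochainsShortComplex (h : TopSplitExact.{v, w} f g) :
    ShortComplex (CochainComplex (ModuleCat.{max v w} ℤ) ℕ) :=
  .mk (cochainsMap.{v, w} (ContinuousMonoidHom.id Γ) f)
    (cochainsMap.{v, w} (ContinuousMonoidHom.id Γ) g) <| by
    ext n x
    refine cochainVal_injective ?_
    obtain ⟨_, _, _, _, h', _⟩ := h.exists_splitting_level (n + 1)
    exact h' _

theorem shortExact_cochainsShortComplex [LocallyCompactSpace Γ] :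
    h.cochainsShortComplex.ShortExact := by
  refine HomologicalComplex.shortExact_of_degreewise_shortExact _ fun n =>
    .mk' ((ShortComplex.moduleCat_exact_iff _).2 fun b hb => ?_)
    ((ModuleCat.mono_iff_injective _).2 fun a a' haa => ?_)
    ((ModuleCat.epi_iff_surjective _).2 fun c => ?_)
  · obtain ⟨a, ha, ha'⟩ := h.exists_level_eq (b := cochainVal n b)
      congr(cochainVal (X := C) n $hb) (exists_cochainVal_eq_iff.1 ⟨b, rfl⟩)
    obtain ⟨a, rfl⟩ := exists_cochainVal_eq_iff.2 ha'
    exact ⟨a, cochainVal_injective ha⟩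
  · exact cochainVal_injective (h.level_injective _ congr(cochainVal (X := B) n $haa))
  · obtain ⟨b, hb, hb'⟩ := h.exists_invariant_lift (exists_cochainVal_eq_iff.1 ⟨c, rfl⟩)
    obtain ⟨b, rfl⟩ := exists_cochainVal_eq_iff.2 hb'
    exact ⟨b, cochainVal_injective hb⟩

omit h in
/-- The connecting homomorphism of a topologically split short exact sequence. -/
def δ [LocallyCompactSpace Γ] (h : TopSplitExact.{v, w} f g) (n : ℕ) :
    Coh.{v, w} n C →+ Coh.{v, w} (n + 1) A :=
  (homologyEquiv (n + 1) A).toAddMonoidHom.comp <|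
    (h.shortExact_cochainsShortComplex.δ n (n + 1) rfl).hom.toAddMonoidHom.comp
      (homologyEquiv n C).symm.toAddMonoidHom

variable [LocallyCompactSpace Γ]

theorem δ_homologyEquiv (n : ℕ) (x : (cochains.{v, w} C).homology n) :
    h.δ n (homologyEquiv n C x) =
      homologyEquiv (n + 1) A (h.shortExact_cochainsShortComplex.δ n (n + 1) rfl x) :=
  congr(homologyEquiv (n + 1) A (h.shortExact_cochainsShortComplex.δ n (n + 1) rfl
    $((homologyEquiv n C).symm_apply_apply x)))

theorem exact_δ_map (n : ℕ) : Function.Exact (h.δ n) (map (n + 1) f) :=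
  .of_ladder_addEquiv_of_exact
    (f₁₂ := (h.shortExact_cochainsShortComplex.δ n (n + 1) rfl).hom.toAddMonoidHom)
    (f₂₃ := (homologyMap f (n + 1)).hom.toAddMonoidHom)
    (homologyEquiv n C) (homologyEquiv (n + 1) A) (homologyEquiv (n + 1) B)
    (AddMonoidHom.ext (h.δ_homologyEquiv n)) (AddMonoidHom.ext (map_homologyEquiv f (n + 1)))
    ((ShortComplex.ShortExact.moduleCat_exact_iff_function_exact _).1
      (h.shortExact_cochainsShortComplex.homology_exact₁ n (n + 1) rfl))

theorem exact_map_map (n : ℕ) : Function.Exact (map.{v, w} n f) (map n g) :=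
  .of_ladder_addEquiv_of_exact
    (f₁₂ := (homologyMap f n).hom.toAddMonoidHom) (f₂₃ := (homologyMap g n).hom.toAddMonoidHom)
    (homologyEquiv n A) (homologyEquiv n B) (homologyEquiv n C)
    (AddMonoidHom.ext (map_homologyEquiv f n)) (AddMonoidHom.ext (map_homologyEquiv g n))
    ((ShortComplex.ShortExact.moduleCat_exact_iff_function_exact _).1
      (h.shortExact_cochainsShortComplex.homology_exact₂ n))

theorem exact_map_δ (n : ℕ) : Function.Exact (map n g) (h.δ n) :=
  .of_ladder_addEquiv_of_exact
    (f₁₂ := (homologyMap g n).hom.toAddMonoidHom)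
    (f₂₃ := (h.shortExact_cochainsShortComplex.δ n (n + 1) rfl).hom.toAddMonoidHom)
    (homologyEquiv n B) (homologyEquiv n C) (homologyEquiv (n + 1) A)
    (AddMonoidHom.ext (map_homologyEquiv g n)) (AddMonoidHom.ext (h.δ_homologyEquiv n))
    ((ShortComplex.ShortExact.moduleCat_exact_iff_function_exact _).1
      (h.shortExact_cochainsShortComplex.homology_exact₃ n (n + 1) rfl))

omit h in
theorem pullback_δ [LocallyCompactSpace Δ] (φ : Δ →ₜ* Γ) {A' B' C' : TopRep.{max v w} ℤ Δ}
    {f' : A' ⟶ B'} {g' : B' ⟶ C'} (h : TopSplitExact.{v, w} f g) (h' : TopSplitExact.{v, w} f' g')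
    (a : TopRep.res (φ : Δ →* Γ) A ⟶ A') (b : TopRep.res (φ : Δ →* Γ) B ⟶ B')
    (c : TopRep.res (φ : Δ →* Γ) C ⟶ C') (hf : (resFunctor (φ : Δ →* Γ)).map f ≫ b = a ≫ f')
    (hg : (resFunctor (φ : Δ →* Γ)).map g ≫ c = b ≫ g') (n : ℕ) (x : Coh.{v, w} n C) :
    pullback φ a (n + 1) (h.δ n x) = h'.δ n (pullback φ c n x) := by
  obtain ⟨x, rfl⟩ := (homologyEquiv n C).surjective x
  let Φ : h.cochainsShortComplex ⟶ h'.cochainsShortComplex :=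
    { τ₁ := cochainsMap φ a
      τ₂ := cochainsMap φ b
      τ₃ := cochainsMap φ c
      comm₁₂ := (cochainsMap_comp φ (ContinuousMonoidHom.id Δ) a f').symm.trans <|
        hf ▸ cochainsMap_comp (ContinuousMonoidHom.id Γ) φ f b
      comm₂₃ := (cochainsMap_comp φ (ContinuousMonoidHom.id Δ) b g').symm.trans <|
        hg ▸ cochainsMap_comp (ContinuousMonoidHom.id Γ) φ g c }
  have hΦ := HomologicalComplex.HomologySequence.δ_naturality Φ h.shortExact_cochainsShortComplex
    h'.shortExact_cochainsShortComplex n (n + 1) rfl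
  calc
    _ = pullback φ a (n + 1) (homologyEquiv (n + 1) A _) := congrArg _ (h.δ_homologyEquiv n x)
    _ = homologyEquiv (n + 1) A' _ := pullback_homologyEquiv φ a (n + 1) _
    _ = homologyEquiv (n + 1) A' _ := congr(homologyEquiv (n + 1) A' ($hΦ x))
    _ = h'.δ n (homologyEquiv n C' _) := (h'.δ_homologyEquiv n _).symm
    _ = _ := congrArg (h'.δ n) (pullback_homologyEquiv φ c n x).symm

end TopSplitExact

theorem subsingleton_of_exact (h : ∀ F, (∀ g, (resolutionX X (n + 2)).ρ g F = F) →
      d X (n + 2) F = 0 → ∃ E, (∀ g, (resolutionX X (n + 1)).ρ g E = E) ∧ d X (n + 1) E = F) :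
    Subsingleton (Coh.{v, w} (n + 1) X) := by
  have hexact : (cochains.{v, w} X).ExactAt (n + 1) := by
    rw [HomologicalComplex.exactAt_iff' _ n (n + 1) (n + 2) (by simp) (by simp),
      ShortComplex.moduleCat_exact_iff]
    intro F hF
    obtain ⟨E, hE, hd⟩ := h (cochainVal (n + 1) F) (exists_cochainVal_eq_iff.1 ⟨F, rfl⟩)
      ((cochainVal_d F).symm.trans congr(cochainVal (n + 2) $hF))
    obtain ⟨E, rfl⟩ := exists_cochainVal_eq_iff.2 hE
    exact ⟨E, cochainVal_injective ((cochainVal_d E).trans hd)⟩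
  have := ModuleCat.subsingleton_of_isZero
    (((cochains.{v, w} X).exactAt_iff_isZero_homology _).1 hexact)
  exact (homologyEquiv (n + 1) X).symm.injective.subsingleton

end Coh

/-! ### Degree zero and contractions -/

namespace Coh

open TopRep ContRepresentation

variable {Γ Δ : Type v} [Group Γ] [TopologicalSpace Γ] [IsTopologicalGroup Γ]
  [Group Δ] [TopologicalSpace Δ] [IsTopologicalGroup Δ]
  {X : TopRep.{max v w} ℤ Γ} {Y : TopRep.{max v w} ℤ Δ}

section DegreeZero

/-- The subgroup of invariant elements of a module. -/
def invariants (X : TopRep.{max v w} ℤ Γ) : AddSubgroup X where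
  carrier := {x | ∀ g, X.ρ g x = x}
  zero_mem' _ := map_zero _
  add_mem' h₁ h₂ g := by rw [map_add, h₁, h₂]
  neg_mem' h g := by rw [map_neg, h]

/-- The inclusion of the homology in degree zero into the cochains of degree zero. -/
abbrev homologyι (X : TopRep.{max v w} ℤ Γ) :
    (cochains.{v, w} X).homology 0 ⟶ (cochains.{v, w} X).X 0 :=
  (cochains.{v, w} X).isoHomologyπ₀.inv ≫ (cochains.{v, w} X).iCycles 0

/-- The homogeneous `0`-cocycle representing a cohomology class of degree zero. -/
def cocycle (X : TopRep.{max v w} ℤ Γ) : Coh.{v, w} 0 X →+ (cochains.{v, w} X).X 0 :=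
  (homologyι X).hom.toAddMonoidHom.comp (homologyEquiv 0 X).symm.toAddMonoidHom

theorem cocycle_homologyEquiv (z : (cochains.{v, w} X).homology 0) :
    cocycle X (homologyEquiv 0 X z) = homologyι X z :=
  congr(homologyι X $((homologyEquiv 0 X).symm_apply_apply z))

theorem cocycle_injective : Function.Injective (cocycle.{v, w} X) :=
  ((ModuleCat.mono_iff_injective (homologyι.{v, w} X)).1 inferInstance).comp
    (homologyEquiv 0 X).symm.injective

theorem exists_cocycle_eq_iff {F : (cochains.{v, w} X).X 0} :
    (∃ c, cocycle X c = F) ↔ (cochains.{v, w} X).d 0 1 F = 0 := by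
  constructor
  · rintro ⟨c, rfl⟩
    exact congr($((cochains.{v, w} X).iCycles_d 0 1) _)
  · intro hF
    have hexact := (ShortComplex.mk _ _ ((cochains.{v, w} X).iCycles_d 0 1)).exact_of_f_is_kernel
      ((cochains X).cyclesIsKernel 0 1 (by simp))
    obtain ⟨z, rfl⟩ := (ShortComplex.moduleCat_exact_iff _).1 hexact F hF
    refine ⟨homologyEquiv 0 X ((cochains X).isoHomologyπ₀.hom z), ?_⟩
    exact (cocycle_homologyEquiv _).trans
      congr($((cochains X).isoHomologyπ₀.hom_inv_id_assoc ((cochains X).iCycles 0)) z)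

theorem cocycle_pullback (φ : Δ →ₜ* Γ) (f : TopRep.res (φ : Δ →* Γ) X ⟶ Y) (c : Coh.{v, w} 0 X) :
    cocycle Y (pullback φ f 0 c) = (cochainsMap φ f).f 0 (cocycle X c) := by
  have h : HomologicalComplex.homologyMap (cochainsMap.{v, w} φ f) 0 ≫ homologyι Y =
      homologyι X ≫ (cochainsMap φ f).f 0 := by
    simp
  obtain ⟨c, rfl⟩ := (homologyEquiv 0 X).surjective c
  calc
    _ = cocycle Y (homologyEquiv 0 Y _) := congrArg _ (pullback_homologyEquiv φ f 0 c)
    _ = homologyι Y _ := cocycle_homologyEquiv _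
    _ = (cochainsMap φ f).f 0 (homologyι X c) := congr($h c)
    _ = _ := congrArg _ (cocycle_homologyEquiv c).symm

/-- The value of the constant cocycle representing a cohomology class of degree zero. -/
def constantValue (X : TopRep.{max v w} ℤ Γ) (c : Coh.{v, w} 0 X) : X :=
  (cochainVal 0 (cocycle X c) : C(Γ, X)) 1

theorem cochainVal_cocycle (c : Coh.{v, w} 0 X) :
    cochainVal 0 (cocycle X c) = ContinuousMap.const Γ (constantValue X c) := by
  have hc : d X 1 (cochainVal 0 (cocycle X c)) = 0 :=
    (cochainVal_d _).symm.trans congr(cochainVal 1 $(exists_cocycle_eq_iff.1 ⟨c, rfl⟩))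
  refine ContinuousMap.ext fun x => ?_
  have hx : (cochainVal 0 (cocycle X c) : C(Γ, X)) x - constantValue X c = 0 := congr($hc 1 x)
  exact sub_eq_zero.1 hx

theorem constantValue_mem (c : Coh.{v, w} 0 X) : constantValue X c ∈ invariants X := fun g => by
  have hg := exists_cochainVal_eq_iff.1 ⟨cocycle X c, rfl⟩ g
  rw [cochainVal_cocycle] at hg
  exact congr($hg 1)

/-- Cohomology in degree zero is the group of invariants. -/
def zeroEquiv (X : TopRep.{max v w} ℤ Γ) : Coh.{v, w} 0 X ≃+ invariants X :=
  AddEquiv.ofBijective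
    (AddMonoidHom.mk' (fun c => (⟨constantValue X c, constantValue_mem c⟩ : invariants X))
      fun a b => Subtype.ext congr((cochainVal 0 $(map_add (cocycle X) a b) : C(Γ, X)) 1)) <| by
    constructor
    · intro a b hab
      refine cocycle_injective (cochainVal_injective ?_)
      rw [cochainVal_cocycle, cochainVal_cocycle]
      exact congr(ContinuousMap.const Γ $(congr_arg Subtype.val hab))
    · intro x
      obtain ⟨F, hF⟩ := exists_cochainVal_eq_iff.{v, w} (X := X) (n := 0)
        (F := ContinuousMap.const Γ x.1).2 fun g => ContinuousMap.ext fun _ => x.2 g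
      obtain ⟨c, rfl⟩ := exists_cocycle_eq_iff.2 <| cochainVal_injective <|
        (cochainVal_d F).trans <| (congr_arg _ hF).trans <|
          ContinuousMap.ext fun _ => ContinuousMap.ext fun _ => sub_self x.1
      exact ⟨c, Subtype.ext congr(($hF : C(Γ, X)) 1)⟩

theorem coe_zeroEquiv_pullback (φ : Δ →ₜ* Γ) (f : TopRep.res (φ : Δ →* Γ) X ⟶ Y)
    (c : Coh.{v, w} 0 X) :
    (zeroEquiv Y (pullback φ f 0 c) : Y) = f (zeroEquiv X c : X) :=
  calc
    _ = (cochainVal 0 ((cochainsMap φ f).f 0 (cocycle X c)) : C(Δ, Y)) 1 :=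
      congr((cochainVal 0 $(cocycle_pullback φ f c) : C(Δ, Y)) 1)
    _ = f ((cochainVal 0 (cocycle X c) : C(Γ, X)) (φ 1)) := rfl
    _ = f (zeroEquiv X c : X) := congr(f (($(cochainVal_cocycle c) : C(Γ, X)) (φ 1)))

end DegreeZero

section Contraction

/-- The contracting homotopy of the standard resolution attached to a retraction of
`X → C(Γ, X)`. -/
def contraction (s : X.coind₁ ⟶ X) : (n : ℕ) → (resolutionX X (n + 1) ⟶ resolutionX X n)
  | 0 => s
  | n + 1 => -(coind₁Functor ℤ Γ).map (contraction s n)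

theorem contraction_d (s : X.coind₁ ⟶ X) (hs : ∀ x : X, s (ContinuousMap.const Γ x) = x) (n : ℕ)
    (F : resolutionX X (n + 1)) :
    contraction s (n + 1) (d X (n + 1) F) + d X n (contraction s n F) = F := by
  induction n with
  | zero =>
    refine ContinuousMap.ext fun x => ?_
    change -(s (F - ContinuousMap.const Γ (F x))) + s F = F x
    rw [map_sub, hs]
    abel
  | succ n ih =>
    refine ContinuousMap.ext fun x => ?_
    change -(contraction s (n + 1) (F - d X (n + 1) (F x))) +
      (contraction s (n + 1) F - d X n (-(contraction s n (F x)))) = F x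
    rw [map_sub, map_neg]
    refine Eq.trans ?_ (ih (F x))
    abel

theorem subsingleton_of_retraction (s : X.coind₁ ⟶ X)
    (hs : ∀ x : X, s (ContinuousMap.const Γ x) = x) (n : ℕ) :
    Subsingleton (Coh.{v, w} (n + 1) X) :=
  subsingleton_of_exact fun F hF hd => by
    refine ⟨contraction s (n + 1) F, fun g => ?_, ?_⟩
    · rw [← hom_comm_apply, hF]
    · have := contraction_d s hs (n + 1) F
      rwa [hd, map_zero, zero_add] at this

end Contraction

end Coh

/-! ### Dimension shifting -/

namespace Coh

open TopRep ContRepresentation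

variable {Γ : Type v} [Group Γ] [TopologicalSpace Γ] [IsTopologicalGroup Γ]

section Constructors

variable {k : Type*} [Ring k] [TopologicalSpace k]

omit [TopologicalSpace Γ] [IsTopologicalGroup Γ] in
theorem continuous_ρ (X : TopRep k Γ) (g : Γ) : Continuous (X.ρ g) :=
  (X.ρ g).cont

omit [TopologicalSpace Γ] [IsTopologicalGroup Γ] in
theorem ρ_mul_apply (X : TopRep k Γ) (g h : Γ) (x : X) : X.ρ (g * h) x = X.ρ g (X.ρ h x) :=
  congr($(map_mul X.ρ g h) x)

omit [TopologicalSpace Γ] [IsTopologicalGroup Γ] in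
theorem ρ_inv_apply_self (X : TopRep k Γ) (g : Γ) (x : X) : X.ρ g⁻¹ (X.ρ g x) = x := by
  rw [← ρ_mul_apply, inv_mul_cancel, map_one]; rfl

omit [TopologicalSpace Γ] [IsTopologicalGroup Γ] in
theorem ρ_self_inv_apply (X : TopRep k Γ) (g : Γ) (x : X) : X.ρ g (X.ρ g⁻¹ x) = x := by
  rw [← ρ_mul_apply, mul_inv_cancel, map_one]; rfl

omit [TopologicalSpace Γ] [IsTopologicalGroup Γ] in
theorem continuous_hom {X Y : TopRep k Γ} (f : X ⟶ Y) : Continuous f :=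
  f.hom.cont

/-- The morphism of topological representations given by a continuous equivariant linear map. -/
def homOfLinear {X Y : TopRep k Γ} (f : X →+ Y) (hf : Continuous f)
    (h : ∀ (g : Γ) (x : X), f (X.ρ g x) = Y.ρ g (f x))
    (hs : ∀ (c : k) (x : X), f (c • x) = c • f x) : X ⟶ Y :=
  TopRep.ofHom
    { toFun := f
      map_add' := f.map_add
      map_smul' := hs
      cont := hf
      isIntertwining' := fun g => ContinuousLinearMap.ext (h g) }

/-- The morphism of modules given by a continuous equivariant additive map. -/
def homMk {X Y : TopRep.{max v w} ℤ Γ} (f : X →+ Y) (hf : Continuous f)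
    (h : ∀ (g : Γ) (x : X), f (X.ρ g x) = Y.ρ g (f x)) : X ⟶ Y :=
  homOfLinear f hf h fun c x => (congr_arg f (int_smul_eq_zsmul X.hV2 c x)).trans <|
    (map_zsmul f c x).trans (int_smul_eq_zsmul Y.hV2 c (f x)).symm

/-- The action of a group element as an additive map. -/
def ρAddHom (X : TopRep.{max v w} ℤ Γ) (g : Γ) : X →+ X where
  toFun := X.ρ g
  map_zero' := map_zero _
  map_add' := map_add _

/-- A module over `Γ` from an action of `Γ` by continuous additive maps. -/
def repMk (V : Type max v w) [AddCommGroup V] [TopologicalSpace V] [IsTopologicalAddGroup V]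
    (ρ : Γ → V →+ V) (hρ : ∀ g, Continuous (ρ g)) (h₁ : ∀ x, ρ 1 x = x)
    (h₂ : ∀ g h x, ρ (g * h) x = ρ g (ρ h x)) : TopRep.{max v w} ℤ Γ :=
  TopRep.of (ContRepresentation.ofMonoidHom
    { toFun := fun g =>
        { toFun := ρ g
          map_add' := map_add _
          map_smul' := fun c x => map_zsmul (ρ g) c x
          cont := hρ g }
      map_one' := ContinuousLinearMap.ext h₁
      map_mul' := fun g h => ContinuousLinearMap.ext (h₂ g h) })

end Constructors

section Shift

variable (X : TopRep.{max v w} ℤ Γ)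

/-- The functions on `Γ` that vanish at `1`. -/
def vanishing : AddSubgroup C(Γ, X) where
  carrier := {F | F 1 = 0}
  zero_mem' := rfl
  add_mem' h₁ h₂ := (congr_arg₂ _ h₁ h₂).trans (add_zero _)
  neg_mem' h := (congr_arg _ h).trans neg_zero

/-- The projection of `C(Γ, X)` onto the functions vanishing at `1`. -/
def toVanishing : C(Γ, X) →+ vanishing X where
  toFun F := ⟨F - ContinuousMap.const Γ (F 1), sub_self _⟩
  map_zero' := Subtype.ext (ContinuousMap.ext fun _ => sub_self _)
  map_add' _ _ := Subtype.ext (ContinuousMap.ext fun _ => add_sub_add_comm _ _ _ _)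

omit [IsTopologicalGroup Γ] in
theorem continuous_toVanishing : Continuous (toVanishing X) :=
  (continuous_id.sub (ContinuousMap.continuous_const'.comp (continuous_eval_const 1))).subtype_mk _

omit [IsTopologicalGroup Γ] in
theorem toVanishing_const (x : X) : toVanishing X (ContinuousMap.const Γ x) = 0 :=
  Subtype.ext (ContinuousMap.ext fun _ => sub_self _)

omit [IsTopologicalGroup Γ] in
theorem toVanishing_coe (F : vanishing X) : toVanishing X F.1 = F :=
  Subtype.ext (ContinuousMap.ext fun _ => (congr_arg _ F.2).trans (sub_zero _))

theorem toVanishing_coind₁_coe_toVanishing (g : Γ) (F : C(Γ, X)) :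
    toVanishing X (X.coind₁.ρ g (toVanishing X F : C(Γ, X))) = toVanishing X (X.coind₁.ρ g F) := by
  change toVanishing X (X.coind₁.ρ g (F - ContinuousMap.const Γ (F 1))) = _
  rw [map_sub, map_sub]
  exact sub_eq_self.2 (toVanishing_const X (X.ρ g (F 1)))

/-- The quotient of `C(Γ, X)` by the constant functions, realised as the module of functions
vanishing at `1`. -/
def shift : TopRep.{max v w} ℤ Γ :=
  repMk (vanishing X)
    (fun g => (toVanishing X).comp ((ρAddHom X.coind₁ g).comp (vanishing X).subtype))
    (fun g => (continuous_toVanishing X).comp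
      ((continuous_ρ X.coind₁ g).comp continuous_subtype_val))
    (fun F => (congr_arg (toVanishing X) congr($(map_one X.coind₁.ρ) F.1)).trans
      (toVanishing_coe X F))
    (fun g h F => (congr_arg (toVanishing X) congr($(map_mul X.coind₁.ρ g h) F.1)).trans
      (toVanishing_coind₁_coe_toVanishing X g (X.coind₁.ρ h F.1)).symm)

/-- The projection `C(Γ, X) → shift X`. -/
def toShift : X.coind₁ ⟶ shift X :=
  homMk (toVanishing X) (continuous_toVanishing X)
    fun g F => (toVanishing_coind₁_coe_toVanishing X g F).symm

/-- The inclusion of `X` into `C(Γ, X)` as constant functions. -/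
abbrev toCoind₁ : X ⟶ X.coind₁ := d X 0

variable {X} in
theorem topSplitExact_shift [LocallyCompactSpace Γ] (hX : HasContinuousAction.{v, w} X) :
    TopSplitExact.{v, w} (toCoind₁ X) (toShift X) where
  continuousAction := hX.resolutionX 1
  exists_splitting := ⟨⟨fun F : C(Γ, X) => F 1, continuous_eval_const 1⟩,
    ⟨fun F : vanishing X => F.1, continuous_subtype_val⟩, fun x => rfl,
    fun F => toVanishing_coe X F, fun x => toVanishing_const X x, fun F hF => by
      have : (F : C(Γ, X)) - ContinuousMap.const Γ ((F : C(Γ, X)) 1) = 0 := congr_arg Subtype.val hF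
      exact (sub_eq_zero.1 this).symm⟩

/-- The restriction to the diagonal, a retraction of `C(Γ, X) → C(Γ, C(Γ, X))`. -/
def diag [LocallyCompactSpace Γ] : X.coind₁.coind₁ ⟶ X.coind₁ :=
  homMk (Y := X.coind₁)
    (AddMonoidHom.mk' (fun F : C(Γ, C(Γ, X)) => (⟨fun x => F x x,
        ContinuousEval.continuous_eval.comp (F.continuous.prodMk continuous_id)⟩ : C(Γ, X)))
      fun _ _ => rfl)
    (ContinuousMap.continuous_of_continuous_uncurry _ (by
      have h : Continuous fun p : C(Γ, C(Γ, X)) × Γ => (p.1 p.2, p.2) :=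
        ContinuousEval.continuous_eval.prodMk continuous_snd
      exact ContinuousEval.continuous_eval.comp h))
    (fun g F => rfl)

theorem subsingleton_coind₁ [LocallyCompactSpace Γ] (n : ℕ) :
    Subsingleton (Coh.{v, w} (n + 1) X.coind₁) :=
  subsingleton_of_retraction (diag X) (fun _ => rfl) n

variable {A B : TopRep.{max v w} ℤ Γ}

/-- Composition with a morphism of modules, as a morphism `C(Γ, A) → C(Γ, B)`. -/
def coind₁Map (f : A ⟶ B) : A.coind₁ ⟶ B.coind₁ :=
  (coind₁Functor ℤ Γ).map f

/-- The functoriality of `shift`. -/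
def shiftMap (f : A ⟶ B) : shift.{v, w} A ⟶ shift.{v, w} B :=
  homMk (X := shift.{v, w} A) (Y := shift.{v, w} B)
    { toFun := fun F : vanishing A =>
        (⟨coind₁Map f F.1, (congr_arg f F.2).trans (map_zero _)⟩ : vanishing B)
      map_zero' := Subtype.ext (map_zero _)
      map_add' := fun _ _ => Subtype.ext (map_add _ _ _) }
    (((continuous_hom (coind₁Map f)).comp continuous_subtype_val).subtype_mk _)
    (fun g F => Subtype.ext (ContinuousMap.ext fun x => by
      change f (A.ρ g ((F : vanishing A).1 (g⁻¹ * x)) - A.ρ g ((F : vanishing A).1 (g⁻¹ * 1))) =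
        B.ρ g (f ((F : vanishing A).1 (g⁻¹ * x))) - B.ρ g (f ((F : vanishing A).1 (g⁻¹ * 1)))
      rw [map_sub, hom_comm_apply, hom_comm_apply]))

theorem toCoind₁_coind₁Map (f : A ⟶ B) : toCoind₁ A ≫ coind₁Map f = f ≫ toCoind₁ B :=
  rfl

theorem toShift_shiftMap (f : A ⟶ B) : toShift A ≫ shiftMap f = coind₁Map f ≫ toShift B :=
  TopRep.Hom.ext (DFunLike.ext _ _ fun F => Subtype.ext <| ContinuousMap.ext fun y =>
    map_sub f.hom ((F : C(Γ, A)) y) ((F : C(Γ, A)) 1))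

end Shift

/-! ### Functoriality of the long exact sequence -/

section Functoriality

variable {Δ : Type v} [Group Δ] [TopologicalSpace Δ] [IsTopologicalGroup Δ]
  {A B C : TopRep.{max v w} ℤ Γ}

theorem map_map (f : A ⟶ B) (g : B ⟶ C) (n : ℕ) (x : Coh.{v, w} n A) :
    map n g (map n f x) = map n (f ≫ g) x :=
  pullback_pullback (ContinuousMonoidHom.id Γ) (ContinuousMonoidHom.id Γ) f g n x

theorem res_map (φ : Δ →ₜ* Γ) (f : A ⟶ B) (n : ℕ) (x : Coh.{v, w} n A) :
    res φ n B (map n f x) = map n ((TopRep.resFunctor (φ : Δ →* Γ)).map f) (res φ n A x) :=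
  (pullback_pullback (ContinuousMonoidHom.id Γ) φ f (𝟙 (TopRep.res (φ : Δ →* Γ) B)) n x).trans
    (pullback_pullback φ (ContinuousMonoidHom.id Δ) (𝟙 (TopRep.res (φ : Δ →* Γ) A))
      ((TopRep.resFunctor (φ : Δ →* Γ)).map f) n x).symm

/-- The map on invariants induced by a morphism of modules. -/
def invariantsMap (f : A ⟶ B) : invariants A →+ invariants B where
  toFun x := ⟨f x.1, fun g => (hom_comm_apply f g x.1).symm.trans (congr_arg f (x.2 g))⟩
  map_zero' := Subtype.ext (map_zero f.hom)
  map_add' _ _ := Subtype.ext (map_add f.hom _ _)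

theorem zeroEquiv_map (f : A ⟶ B) (c : Coh.{v, w} 0 A) :
    zeroEquiv B (map 0 f c) = invariantsMap f (zeroEquiv A c) :=
  Subtype.ext (coe_zeroEquiv_pullback (ContinuousMonoidHom.id Γ) f c)

namespace TopSplitExact

variable {f : A ⟶ B} {g : B ⟶ C}

omit [IsTopologicalGroup Γ] [IsTopologicalGroup Δ] in
theorem res (h : TopSplitExact.{v, w} f g) (φ : Δ →ₜ* Γ) :
    TopSplitExact.{v, w} ((TopRep.resFunctor (φ : Δ →* Γ)).map f)
      ((TopRep.resFunctor (φ : Δ →* Γ)).map g) where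
  continuousAction := h.continuousAction.comp
    (((map_continuous φ).comp continuous_fst).prodMk continuous_snd)
  exists_splitting := h.exists_splitting

variable [LocallyCompactSpace Γ] (h : TopSplitExact.{v, w} f g)
include h

theorem res_δ [LocallyCompactSpace Δ] (φ : Δ →ₜ* Γ) (n : ℕ) (x : Coh.{v, w} n C) :
    Coh.res φ (n + 1) A (h.δ n x) = (h.res φ).δ n (Coh.res φ n C x) :=
  pullback_δ φ h (h.res φ) (𝟙 (TopRep.res (φ : Δ →* Γ) A)) (𝟙 (TopRep.res (φ : Δ →* Γ) B))
    (𝟙 (TopRep.res (φ : Δ →* Γ) C)) rfl rfl n x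

theorem map_δ {A' B' C' : TopRep.{max v w} ℤ Γ} {f' : A' ⟶ B'} {g' : B' ⟶ C'}
    (h' : TopSplitExact.{v, w} f' g') (a : A ⟶ A') (b : B ⟶ B') (c : C ⟶ C')
    (hf : f ≫ b = a ≫ f') (hg : g ≫ c = b ≫ g') (n : ℕ) (x : Coh.{v, w} n C) :
    map (n + 1) a (h.δ n x) = h'.δ n (map n c x) :=
  pullback_δ (ContinuousMonoidHom.id Γ) h h' a b c hf hg n x

omit h in
/-- The connecting map from degree zero, on invariants. -/
def invariantδ (h : TopSplitExact.{v, w} f g) : invariants C →+ Coh.{v, w} 1 A :=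
  (h.δ 0).comp (zeroEquiv C).symm.toAddMonoidHom

theorem invariantδ_eq_zero_iff (c : invariants C) :
    h.invariantδ c = 0 ↔ c ∈ (invariantsMap g).range := by
  refine (h.exact_map_δ 0 ((zeroEquiv C).symm c)).trans ⟨?_, ?_⟩
  · rintro ⟨y, hy⟩
    exact ⟨zeroEquiv B y, by rw [← zeroEquiv_map, hy, AddEquiv.apply_symm_apply]⟩
  · rintro ⟨b, rfl⟩
    exact ⟨(zeroEquiv B).symm b, (zeroEquiv C).injective <| by
      rw [zeroEquiv_map, AddEquiv.apply_symm_apply, AddEquiv.apply_symm_apply]⟩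

theorem invariantδ_surjective [Subsingleton (Coh.{v, w} 1 B)] :
    Function.Surjective h.invariantδ := by
  intro x
  obtain ⟨y, rfl⟩ := (h.exact_δ_map 0 x).1 (Subsingleton.elim _ _)
  exact ⟨zeroEquiv C y, congr_arg (h.δ 0) ((zeroEquiv C).symm_apply_apply y)⟩

end TopSplitExact

end Functoriality

end Coh

/-! ### Difference equations on the integers -/

section Difference

variable {A : Type*} [AddCommGroup A]

theorem eq_apply_zero_of_fwdDiff_eq_zero {f : ℤ → A} (h : fwdDiff 1 f = 0) (z : ℤ) :
    f z = f 0 := by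
  have h (z : ℤ) : f (z + 1) = f z := sub_eq_zero.1 congr($h z)
  induction z with
  | zero => rfl
  | succ n ih => rw [h, ih]
  | pred n ih => rw [← ih, ← h, sub_add_cancel]

theorem eq_add_of_fwdDiff_eq {f g : ℤ → A} (h : fwdDiff 1 f = fwdDiff 1 g) (z : ℤ) :
    f z = g z + (f 0 - g 0) := by
  have hfg : fwdDiff 1 (f - g) = 0 := funext fun z =>
    (sub_sub_sub_comm _ _ _ _).trans (sub_eq_zero.2 congr($h z))
  exact sub_eq_iff_eq_add'.1 (eq_apply_zero_of_fwdDiff_eq_zero hfg z)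

/-- The sum of `f` over the integers from `0` to `z`, with a sign when `z` is negative: the
solution `F` of `fwdDiff 1 F = f` with `F 0 = 0`. -/
def intSum : (ℤ → A) →+ (ℤ → A) where
  toFun f z := ∑ i ∈ Finset.Ico 0 z, f i - ∑ i ∈ Finset.Ico z 0, f i
  map_zero' := funext fun z => by simp
  map_add' f g := funext fun z => by
    simp only [Pi.add_apply, Finset.sum_add_distrib]
    abel

theorem intSum_apply (f : ℤ → A) (z : ℤ) :
    intSum f z = ∑ i ∈ Finset.Ico 0 z, f i - ∑ i ∈ Finset.Ico z 0, f i :=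
  rfl

theorem intSum_apply_zero (f : ℤ → A) : intSum f 0 = 0 := by simp [intSum_apply]

theorem fwdDiff_intSum (f : ℤ → A) : fwdDiff 1 (intSum f) = f := by
  funext z
  rw [fwdDiff, intSum_apply, intSum_apply]
  rcases le_or_gt 0 z with h | h
  · rw [← Finset.insert_Ico_right_eq_Ico_add_one h, Finset.sum_insert Finset.right_notMem_Ico,
      Finset.Ico_eq_empty_of_le h, Finset.Ico_eq_empty_of_le (by omega : (0 : ℤ) ≤ z + 1)]
    simp only [Finset.sum_empty, sub_zero, add_sub_cancel_right]
  · rw [← Finset.insert_Ico_add_one_left_eq_Ico h, Finset.sum_insert (by simp),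
      Finset.Ico_eq_empty_of_le h.le, Finset.Ico_eq_empty_of_le (by omega : z + 1 ≤ (0 : ℤ))]
    simp only [Finset.sum_empty, zero_sub]
    abel

theorem intSum_fwdDiff (f : ℤ → A) (z : ℤ) : intSum (fwdDiff 1 f) z = f z - f 0 := by
  rw [eq_add_of_fwdDiff_eq (fwdDiff_intSum (fwdDiff 1 f)) z, intSum_apply_zero, zero_sub,
    ← sub_eq_add_neg]

variable {f : ℤ → A} {m : ℤ} (hf : Function.Periodic f m)
include hf

theorem intSum_add_of_periodic (z : ℤ) : intSum f (z + m) = intSum f z + intSum f m := by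
  have h : fwdDiff 1 (fun z => intSum f (z + m)) = fwdDiff 1 (intSum f) := funext fun z => by
    rw [fwdDiff, add_right_comm, fwdDiff_intSum, ← hf z]
    exact congr($(fwdDiff_intSum f) (z + m))
  rw [eq_add_of_fwdDiff_eq h, zero_add, intSum_apply_zero, sub_zero]

theorem intSum_nsmul_of_periodic (k : ℕ) : intSum f (k * m) = k • intSum f m := by
  induction k with
  | zero => simp [intSum_apply_zero]
  | succ k ih => rw [Nat.cast_succ, add_mul, one_mul, intSum_add_of_periodic hf, ih, succ_nsmul]

theorem periodic_intSum (h : intSum f m = 0) : Function.Periodic (intSum f) m := fun z => by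
  rw [intSum_add_of_periodic hf, h, add_zero]

end Difference

/-! ### Differences of periodic functions -/

section Periodic

theorem exists_zmod_factorization {A : Type*} {u : ℤ → A} {m : ℕ} (hu : Function.Periodic u m) :
    ∃ v : ZMod m → A, ∀ z : ℤ, v z = u z :=
  ⟨fun a => u a.cast, fun z => by
    have h := hu.int_mul (z / m) (z % m)
    rw [Int.cast_id, mul_comm, Int.emod_add_mul_ediv] at h
    exact (congr_arg u (ZMod.coe_intCast z)).trans h.symm⟩

variable {A : Type*} [AddCommGroup A]

variable (A) in
/-- The group of periodic functions on `ℤ`. -/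
def periodicFunctions : AddSubgroup (ℤ → A) where
  carrier := {f | ∃ m : ℕ, m ≠ 0 ∧ Function.Periodic f m}
  zero_mem' := ⟨1, one_ne_zero, fun _ => rfl⟩
  add_mem' := by
    rintro f g ⟨m, hm, hf⟩ ⟨n, hn, hg⟩
    refine ⟨n * m, mul_ne_zero hn hm, Function.Periodic.add ?_ ?_⟩
    · simpa using hf.nat_mul n
    · simpa [mul_comm] using hg.nat_mul m
  neg_mem' := fun ⟨m, hm, hf⟩ => ⟨m, hm, fun z => congr_arg Neg.neg (hf z)⟩

variable (A) in
/-- The difference operator on periodic functions. -/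
def periodicDiff : periodicFunctions A →+ periodicFunctions A where
  toFun f := ⟨fwdDiff 1 f.1, by
    obtain ⟨m, hm, hf⟩ := f.2
    exact ⟨m, hm, fun z => by rw [fwdDiff, fwdDiff, add_right_comm, hf, hf]⟩⟩
  map_zero' := Subtype.ext (funext fun _ => sub_self _)
  map_add' f g := Subtype.ext (fwdDiff_add 1 f.1 g.1)

theorem mem_range_periodicDiff {f : periodicFunctions A} {m : ℕ} (hm : m ≠ 0)
    (hf : Function.Periodic f.1 m) (h : intSum f.1 m = 0) : f ∈ (periodicDiff A).range :=
  ⟨⟨intSum f.1, m, hm, periodic_intSum hf h⟩, Subtype.ext (fwdDiff_intSum f.1)⟩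

theorem mem_range_periodicDiff_of_nsmul {f : periodicFunctions A} {k : ℕ} (hk : k ≠ 0)
    (h : k • f ∈ (periodicDiff A).range) : f ∈ (periodicDiff A).range := by
  obtain ⟨v, hv⟩ := h
  have hv : fwdDiff 1 v.1 = k • f.1 := congr_arg Subtype.val hv
  obtain ⟨m, hm, hf⟩ := f.2
  obtain ⟨n, hn, hvn⟩ := v.2
  have hf' : Function.Periodic f.1 (n * m : ℤ) := hf.nat_mul n
  have hv' : v.1 (n * m : ℤ) = v.1 0 := by simpa [mul_comm] using hvn.nat_mul m 0
  refine mem_range_periodicDiff (m := k * (n * m)) (by positivity)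
    (by simpa using hf'.nat_mul k) ?_
  push_cast
  rw [intSum_nsmul_of_periodic hf', ← Pi.smul_apply, ← map_nsmul, ← hv, intSum_fwdDiff, hv',
    sub_self]

/-- The function with value `a` on the multiples of `n` and `0` elsewhere. -/
def diracComb (n : ℕ) (a : A) (z : ℤ) : A :=
  if (n : ℤ) ∣ z then a else 0

theorem periodic_diracComb (n : ℕ) (a : A) : Function.Periodic (diracComb n a) n := fun z => by
  simp only [diracComb, dvd_add_self_right]

theorem intSum_diracComb {n : ℕ} (hn : n ≠ 0) (a : A) : intSum (diracComb n a) n = a := by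
  have h (b : ℤ) (hb : b ∈ Finset.Ico (0 : ℤ) n) (hb₀ : b ≠ 0) : diracComb n a b = 0 :=
    if_neg fun hnb => hb₀ <| Int.eq_zero_of_dvd_of_nonneg_of_lt (Finset.mem_Ico.1 hb).1
      (Finset.mem_Ico.1 hb).2 hnb
  rw [intSum_apply, Finset.Ico_eq_empty_of_le n.cast_nonneg, Finset.sum_empty, sub_zero,
    Finset.sum_eq_single_of_mem 0 (by simpa using Nat.pos_of_ne_zero hn) h]
  exact if_pos (dvd_zero _)

theorem exists_sub_nsmul_mem_range_periodicDiff (f : periodicFunctions A) {k : ℕ} (hk : k ≠ 0) :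
    ∃ f' : periodicFunctions A, f - k • f' ∈ (periodicDiff A).range := by
  obtain ⟨m, hm, hf⟩ := f.2
  have hn : k * m ≠ 0 := mul_ne_zero hk hm
  let f' : periodicFunctions A :=
    ⟨diracComb (k * m) (intSum f.1 m), k * m, hn, periodic_diracComb _ _⟩
  have hf₁ : Function.Periodic f.1 (k * m : ℕ) := by simpa using hf.nat_mul k
  have hf' : Function.Periodic (k • f').1 (k * m : ℕ) := fun z =>
    congr_arg (k • ·) (periodic_diracComb (k * m) (intSum f.1 m) z)
  refine ⟨f', mem_range_periodicDiff hn (hf₁.sub hf') ?_⟩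
  change intSum (f.1 - k • diracComb (k * m) (intSum f.1 m)) _ = 0
  rw [map_sub, map_nsmul, Pi.sub_apply, Pi.smul_apply, intSum_diracComb hn, Nat.cast_mul,
    intSum_nsmul_of_periodic hf, sub_self]

end Periodic

/-! ### Discrete modules over compact groups -/

section Discrete

theorem discreteTopology_continuousMap {X Y : Type*} [TopologicalSpace X] [TopologicalSpace Y]
    [CompactSpace X] [DiscreteTopology Y] : DiscreteTopology C(X, Y) := by
  rw [discreteTopology_iff_isOpen_singleton]
  intro f
  have hfin : (Set.range f).Finite := (isCompact_range f.continuous).finite_of_discrete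
  have : {f} = ⋂ y ∈ Set.range f, {g : C(X, Y) | Set.MapsTo g (f ⁻¹' {y}) {y}} := by
    ext g
    simp only [Set.mem_singleton_iff, Set.mem_iInter, Set.mem_ofPred_eq]
    constructor
    · rintro rfl y - x hx
      exact hx
    · intro h
      ext x
      exact h (f x) ⟨x, rfl⟩ rfl
  rw [this]
  refine hfin.isOpen_biInter fun y _ => ContinuousMap.isOpen_setOfPred_mapsTo ?_ (isOpen_discrete _)
  exact ((isClosed_discrete _).preimage f.continuous).isCompact

open TopRep

variable {G : Type v} [Group G] [TopologicalSpace G] {M : TopRep.{max v w} ℤ G}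

/-- The stabiliser of an element of a module. -/
def Coh.stabilizer (M : TopRep.{max v w} ℤ G) (x : M) : Subgroup G where
  carrier := {g | M.ρ g x = x}
  one_mem' := congr($(map_one M.ρ) x)
  mul_mem' {g h} hg hh := (Coh.ρ_mul_apply M g h x).trans ((congr_arg (M.ρ g) hh).trans hg)
  inv_mem' {g} hg := (congr_arg (M.ρ g⁻¹) hg).symm.trans (Coh.ρ_inv_apply_self M g x)

namespace IsDiscreteModule

section

variable [IsTopologicalGroup G] [CompactSpace G] (hM : IsDiscreteModule.{v, w} M)
include hM

theorem coind₁ : IsDiscreteModule.{v, w} M.coind₁ :=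
  have := hM.1
  ⟨discreteTopology_continuousMap (X := G) (Y := M), Coh.HasContinuousAction.resolutionX hM.2 1⟩

theorem shift : IsDiscreteModule.{v, w} (Coh.shift.{v, w} M) := by
  have h₁ := hM.coind₁
  have : DiscreteTopology C(G, M) := h₁.1
  refine ⟨inferInstanceAs (DiscreteTopology (Coh.vanishing M)), ?_⟩
  have h : Continuous fun p : G × Coh.vanishing M => (p.1, p.2.1) :=
    continuous_fst.prodMk (continuous_subtype_val.comp continuous_snd)
  exact (Coh.continuous_toVanishing M).comp (h₁.2.comp h)

end

variable (hM : IsDiscreteModule.{v, w} M)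
include hM

theorem continuous_apply (x : M) : Continuous fun g : G => M.ρ g x :=
  hM.2.comp (continuous_id.prodMk continuous_const)

theorem isOpen_stabilizer (x : M) : IsOpen (Coh.stabilizer M x : Set G) :=
  have := hM.1
  (isOpen_discrete {x}).preimage (hM.continuous_apply x)

theorem finite_orbit [CompactSpace G] (H : Subgroup G) (x : M) :
    {y | ∃ g ∈ H, M.ρ g x = y}.Finite :=
  have := hM.1
  (isCompact_range (hM.continuous_apply x)).finite_of_discrete.subset fun _ ⟨g, _, hg⟩ => ⟨g, hg⟩

/-- The invariant element is the sum over the finite orbit of `b` under `H`. -/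
theorem exists_nsmul_invariant [CompactSpace G] {N : TopRep.{max v w} ℤ G} (p : M ⟶ N)
    (H : Subgroup G) (b : M) (hb : ∀ g ∈ H, p (M.ρ g b) = p b) :
    ∃ (k : ℕ) (c : M), 0 < k ∧ (∀ g ∈ H, M.ρ g c = c) ∧ p c = k • p b := by
  let S := (hM.finite_orbit H b).toFinset
  have mem_S {x : M} : x ∈ S ↔ ∃ g ∈ H, M.ρ g b = x := (hM.finite_orbit H b).mem_toFinset
  have apply_mem_S {g : G} (hg : g ∈ H) {x : M} (hx : x ∈ S) : M.ρ g x ∈ S := by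
    obtain ⟨h, hh, rfl⟩ := mem_S.1 hx
    exact mem_S.2 ⟨g * h, H.mul_mem hg hh, Coh.ρ_mul_apply M g h b⟩
  refine ⟨S.card, ∑ x ∈ S, x, ?_, fun g hg => ?_, ?_⟩
  · exact Finset.card_pos.2 ⟨M.ρ 1 b, mem_S.2 ⟨1, H.one_mem, rfl⟩⟩
  · rw [map_sum]
    exact Finset.sum_nbij' (M.ρ g) (M.ρ g⁻¹) (fun _ => apply_mem_S hg)
      (fun _ => apply_mem_S (H.inv_mem hg)) (fun x _ => Coh.ρ_inv_apply_self M g x)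
      (fun x _ => Coh.ρ_self_inv_apply M g x) fun _ _ => rfl
  · rw [map_sum, Finset.sum_congr rfl (g := fun _ => p b), Finset.sum_const]
    intro x hx
    obtain ⟨h, hh, rfl⟩ := mem_S.1 hx
    exact hb h hh

theorem isAddTorsion_coh_one [IsTopologicalGroup G] [CompactSpace G] :
    IsAddTorsion (Coh.{v, w} 1 M) := by
  intro x
  have h := Coh.topSplitExact_shift hM.2
  have := Coh.subsingleton_coind₁ M 0
  obtain ⟨c, rfl⟩ := h.invariantδ_surjective x
  obtain ⟨r, s, -, hs, -⟩ := h.exists_splitting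
  obtain ⟨k, b, hk, hb, hbc⟩ := hM.coind₁.exists_nsmul_invariant (Coh.toShift M) ⊤ (s c.1)
    fun g _ => by rw [hom_comm_apply, hs, c.2 g]
  refine isOfFinAddOrder_iff_nsmul_eq_zero.2 ⟨k, hk, ?_⟩
  rw [← map_nsmul, h.invariantδ_eq_zero_iff]
  exact ⟨⟨b, fun g => hb g trivial⟩, Subtype.ext (hbc.trans (by rw [hs]; rfl))⟩

end IsDiscreteModule

end Discrete

/-! ### Dense subgroups with an infinite cyclic quotient -/

open TopRep

/-- A group `W` mapping densely to a group `G`, together with a continuous degree map `W → ℤ` that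
extends to the finite quotients `ℤ / m` of `ℤ` on `G`. The map `kerPart` is a continuous splitting
`g ↦ g * s(g)⁻¹` of the extension of the profinite completion of `ℤ` that `G` is, where `s(g)` is
the lift of the degree of `g` for which `s(w) = gen ^ deg w` on `W`. -/
structure DegreeDatum (G W : Type v) [Group G] [TopologicalSpace G] [IsTopologicalGroup G]
  [Group W] [TopologicalSpace W] [IsTopologicalGroup W] where
  toGroup : W →ₜ* G
  denseRange : DenseRange toGroup
  deg : W → ℤ
  deg_mul : ∀ a b, deg (a * b) = deg a + deg b
  continuous_deg : Continuous deg
  gen : W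
  deg_gen : deg gen = 1
  kerPart : C(G, W)
  kerPart_mul : ∀ w g, kerPart (toGroup w * g) = w * kerPart g * gen ^ (-deg w)
  exists_extension : ∀ m : ℕ, m ≠ 0 → ∃ χ : G → ZMod m, IsLocallyConstant χ ∧
    (∀ a b, χ (a * b) = χ a + χ b) ∧ ∀ w, χ (toGroup w) = deg w

namespace DegreeDatum

variable {G W : Type v} [Group G] [TopologicalSpace G] [IsTopologicalGroup G]
  [Group W] [TopologicalSpace W] [IsTopologicalGroup W] (D : DegreeDatum G W)

/-- The degree as a homomorphism. -/
def degHom : W →* Multiplicative ℤ :=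
  MonoidHom.mk' (fun w => .ofAdd (D.deg w)) fun a b => congr_arg _ (D.deg_mul a b)

theorem deg_one : D.deg 1 = 0 := D.degHom.map_one

theorem deg_inv (a : W) : D.deg a⁻¹ = -D.deg a := D.degHom.map_inv a

theorem deg_gen_zpow (z : ℤ) : D.deg (D.gen ^ z) = z := by
  have h : D.degHom D.gen = .ofAdd 1 := congr_arg Multiplicative.ofAdd D.deg_gen
  have h' : D.degHom (D.gen ^ z) = .ofAdd z := by
    rw [map_zpow, h, ← ofAdd_zsmul, smul_eq_mul, mul_one]
  exact h'

theorem kerPart_inv_mul (w : W) (g : G) (z : ℤ) :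
    D.kerPart ((D.toGroup w)⁻¹ * g) * D.gen ^ (z - D.deg w) =
      w⁻¹ * (D.kerPart g * D.gen ^ z) := by
  rw [← map_inv, D.kerPart_mul, D.deg_inv, neg_neg, mul_assoc, ← zpow_add, add_sub_cancel,
    mul_assoc]

section Induced

/-- The `W`-module of functions `ℤ → X`, coinduced from the restriction of `X` to the elements of
degree zero. -/
def coind (X : TopRep.{max v w} ℤ W) : TopRep.{max v w} ℤ W :=
  Coh.repMk.{v, w} (ℤ → X)
    (fun g => AddMonoidHom.mk' (fun f z => X.ρ g (f (z - D.deg g)))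
      fun f f' => funext fun z => map_add _ _ _)
    (fun g => continuous_pi fun z => (Coh.continuous_ρ X g).comp (continuous_apply _))
    (fun f => funext fun z => by
      change X.ρ 1 (f (z - D.deg 1)) = f z
      rw [D.deg_one, sub_zero, map_one]; rfl)
    (fun g h f => funext fun z => by
      change X.ρ (g * h) (f (z - D.deg (g * h))) = X.ρ g (X.ρ h (f (z - D.deg g - D.deg h)))
      rw [D.deg_mul, sub_sub, Coh.ρ_mul_apply])

variable {X Y Z : TopRep.{max v w} ℤ W}

theorem hasContinuousAction_coind (hX : Coh.HasContinuousAction.{v, w} X) :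
    Coh.HasContinuousAction.{v, w} (D.coind X) := by
  refine continuous_pi fun z => ?_
  have h₁ : Continuous fun p : ℤ × (ℤ → X) => p.2 p.1 :=
    continuous_prod_of_discrete_left.2 fun a => continuous_apply a
  have h₂ : Continuous fun p : W × (ℤ → X) => (p.1, p.2 (z - D.deg p.1)) :=
    continuous_fst.prodMk (h₁.comp
      ((continuous_const.sub (D.continuous_deg.comp continuous_fst)).prodMk continuous_snd))
  exact hX.comp h₂

/-- The functoriality of `coind`. -/
def coindMap (f : X ⟶ Y) : D.coind X ⟶ D.coind Y :=
  Coh.homMk (X := D.coind X) (Y := D.coind Y)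
    (AddMonoidHom.mk' (fun (x : ℤ → X) z => f (x z)) fun _ _ => funext fun _ => map_add _ _ _)
    (continuous_pi fun z => (Coh.continuous_hom f).comp (continuous_apply z))
    (fun g _ => funext fun _ => hom_comm_apply f g _)

theorem topSplitExact_coindMap {f : X ⟶ Y} {g : Y ⟶ Z} (h : Coh.TopSplitExact.{v, w} f g) :
    Coh.TopSplitExact.{v, w} (D.coindMap f) (D.coindMap g) := by
  refine ⟨D.hasContinuousAction_coind h.continuousAction, ?_⟩
  obtain ⟨r, s, h₁, h₂, h₃, h₄⟩ := h.exists_splitting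
  refine ⟨⟨fun (y : ℤ → Y) (z : ℤ) => r (y z),
      continuous_pi fun z => r.continuous.comp (continuous_apply z)⟩,
    ⟨fun (y : ℤ → Z) (z : ℤ) => s (y z),
      continuous_pi fun z => s.continuous.comp (continuous_apply z)⟩,
    fun _ => funext fun z => h₁ _, fun _ => funext fun z => h₂ _, fun _ => funext fun z => h₃ _,
    fun b hb => funext fun z => h₄ _ congr($hb z)⟩

/-- The inclusion of `X` as the constant functions. -/
def toCoind (X : TopRep.{max v w} ℤ W) : X ⟶ D.coind X :=
  Coh.homMk (Y := D.coind X)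
    (AddMonoidHom.mk' (fun x _ => x) fun _ _ => rfl)
    (continuous_pi fun _ => continuous_id)
    (fun _ _ => rfl)

/-- The difference operator on functions on `ℤ`. -/
def diff (X : TopRep.{max v w} ℤ W) : D.coind X ⟶ D.coind X :=
  Coh.homMk (X := D.coind X) (Y := D.coind X)
    (AddMonoidHom.mk' (fun f : ℤ → X => fwdDiff 1 f) fun f f' => fwdDiff_add 1 f f')
    (continuous_pi fun z => (continuous_apply (z + 1)).sub (continuous_apply z))
    (fun g f => funext fun z => by
      change X.ρ g (f (z + 1 - D.deg g)) - X.ρ g (f (z - D.deg g)) =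
        X.ρ g (f (z - D.deg g + 1) - f (z - D.deg g))
      rw [map_sub, sub_add_eq_add_sub])

theorem topSplitExact_diff (hX : Coh.HasContinuousAction.{v, w} X) :
    Coh.TopSplitExact.{v, w} (D.toCoind X) (D.diff X) where
  continuousAction := D.hasContinuousAction_coind hX
  exists_splitting := ⟨⟨fun f : ℤ → X => f 0, continuous_apply 0⟩,
    ⟨fun f : ℤ → X => intSum f, continuous_pi fun _ =>
      (continuous_finsetSum _ fun i _ => continuous_apply i).sub
        (continuous_finsetSum _ fun i _ => continuous_apply i)⟩,
    fun _ => rfl, fun f : ℤ → X => fwdDiff_intSum f, fun x => funext fun _ => sub_self x,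
    fun _ hf => funext fun z => (eq_apply_zero_of_fwdDiff_eq_zero hf z).symm⟩

theorem coe_invariant_coind (f : Coh.invariants (D.coind X)) (w : W) (z : ℤ) :
    X.ρ w ((f.1 : ℤ → X) (z - D.deg w)) = (f.1 : ℤ → X) z :=
  congr_fun (f.2 w : (D.coind X).ρ w f.1 = f.1) z

theorem invariant_coind_eq_gen (f : Coh.invariants (D.coind X)) (z : ℤ) :
    (f.1 : ℤ → X) z = X.ρ (D.gen ^ z) ((f.1 : ℤ → X) 0) := by
  rw [← D.coe_invariant_coind f (D.gen ^ z), D.deg_gen_zpow, sub_self]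

theorem invariant_coind_ext {f f' : Coh.invariants (D.coind X)}
    (h : (f.1 : ℤ → X) 0 = (f'.1 : ℤ → X) 0) : f = f' :=
  Subtype.ext <| funext fun z => by rw [D.invariant_coind_eq_gen, h, ← D.invariant_coind_eq_gen]

theorem exists_invariant_coind {b : X} (hb : ∀ w ∈ D.degHom.ker, X.ρ w b = b) :
    ∃ f : Coh.invariants (D.coind X), (f.1 : ℤ → X) 0 = b := by
  let f : ℤ → X := fun z => X.ρ (D.gen ^ z) b
  have hf (w : W) (z : ℤ) : X.ρ w (f (z - D.deg w)) = f z := by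
    have hdeg : D.gen ^ (-z) * (w * D.gen ^ (z - D.deg w)) ∈ D.degHom.ker :=
      congr_arg Multiplicative.ofAdd (by
        rw [D.deg_mul, D.deg_mul, D.deg_gen_zpow, D.deg_gen_zpow]; ring :
          D.deg (D.gen ^ (-z) * (w * D.gen ^ (z - D.deg w))) = 0)
    have hmul : w * D.gen ^ (z - D.deg w) =
        D.gen ^ z * (D.gen ^ (-z) * (w * D.gen ^ (z - D.deg w))) := by
      rw [zpow_neg, mul_inv_cancel_left]
    rw [← Coh.ρ_mul_apply, hmul, Coh.ρ_mul_apply, hb _ hdeg]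
  exact ⟨⟨f, fun w => funext (hf w)⟩,
    (congr_arg (fun g => X.ρ g b) (zpow_zero D.gen)).trans congr($(map_one X.ρ) b)⟩

end Induced

section Acyclic

variable [LocallyCompactSpace G] [LocallyCompactSpace W]

/-- The map `C(W, ℤ → C(G, M)) → (ℤ → C(G, M))`, `F ↦ (z ↦ g ↦ F (kerPart g * gen ^ z) z g)`, an
equivariant retraction onto the constant functions on `W`. -/
def coindRetraction (M : TopRep.{max v w} ℤ G) :
    (D.coind (TopRep.res (D.toGroup : W →* G) M.coind₁)).coind₁ ⟶
      D.coind (TopRep.res (D.toGroup : W →* G) M.coind₁) :=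
  Coh.homMk (X := (D.coind (TopRep.res (D.toGroup : W →* G) M.coind₁)).coind₁)
    (Y := D.coind (TopRep.res (D.toGroup : W →* G) M.coind₁))
    (AddMonoidHom.mk' (fun (F : C(W, ℤ → C(G, M))) z =>
      (⟨fun g => F (D.kerPart g * D.gen ^ z) z g, by
        have h : Continuous fun g => (F (D.kerPart g * D.gen ^ z) z, g) :=
          ((continuous_apply z).comp (F.continuous.comp
            (D.kerPart.continuous.mul continuous_const))).prodMk continuous_id
        exact ContinuousEval.continuous_eval.comp h⟩ : C(G, M)))
      fun _ _ => rfl)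
    (continuous_pi fun z => ContinuousMap.continuous_of_continuous_uncurry _ (by
      have h₁ : Continuous fun p : C(W, ℤ → C(G, M)) × G => (p.1, D.kerPart p.2 * D.gen ^ z) :=
        continuous_fst.prodMk ((D.kerPart.continuous.comp continuous_snd).mul continuous_const)
      have h₂ : Continuous fun p : C(W, ℤ → C(G, M)) × G =>
          (p.1 (D.kerPart p.2 * D.gen ^ z) z, p.2) :=
        ((continuous_apply z).comp (ContinuousEval.continuous_eval.comp h₁)).prodMk continuous_snd
      exact ContinuousEval.continuous_eval.comp h₂))
    (fun w F => funext fun z => ContinuousMap.ext fun g => by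
      change M.ρ (D.toGroup w) ((F : C(W, ℤ → C(G, M))) (w⁻¹ * (D.kerPart g * D.gen ^ z))
          (z - D.deg w) ((D.toGroup w)⁻¹ * g)) =
        M.ρ (D.toGroup w) ((F : C(W, ℤ → C(G, M)))
          (D.kerPart ((D.toGroup w)⁻¹ * g) * D.gen ^ (z - D.deg w))
          (z - D.deg w) ((D.toGroup w)⁻¹ * g))
      rw [kerPart_inv_mul])

theorem subsingleton_coind (M : TopRep.{max v w} ℤ G) (n : ℕ) :
    Subsingleton (Coh.{v, w} (n + 1) (D.coind (TopRep.res (D.toGroup : W →* G) M.coind₁))) :=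
  Coh.subsingleton_of_retraction (D.coindRetraction M) (fun _ => rfl) n

end Acyclic

include D in
theorem locallyCompactSpace [CompactSpace G] : LocallyCompactSpace W := by
  have hcompact : IsCompact ((fun g => D.kerPart g * (D.kerPart 1)⁻¹) '' Set.univ) :=
    isCompact_univ.image (D.kerPart.continuous.mul continuous_const)
  refine hcompact.locallyCompactSpace_of_mem_nhds_of_group (x := 1) (Filter.mem_of_superset
    (((isOpen_discrete {0}).preimage D.continuous_deg).mem_nhds D.deg_one) fun w hw => ?_)
  have hmul := D.kerPart_mul w 1
  rw [show D.deg w = 0 from hw, neg_zero, zpow_zero, mul_one, mul_one] at hmul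
  exact ⟨D.toGroup w, trivial, mul_inv_eq_of_eq_mul hmul⟩

end DegreeDatum

/-! ### Restriction to a dense subgroup -/

namespace DegreeDatum

open TopRep

variable {G W : Type v} [Group G] [TopologicalSpace G] [IsTopologicalGroup G]
  [Group W] [TopologicalSpace W] [IsTopologicalGroup W] (D : DegreeDatum G W)

/-- The restriction of modules to `W`. -/
abbrev resFunctor : TopRep.{max v w} ℤ G ⥤ TopRep.{max v w} ℤ W :=
  TopRep.resFunctor (D.toGroup : W →* G)

/-- The restriction map on cohomology. -/
abbrev res (n : ℕ) (M : TopRep.{max v w} ℤ G) :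
    Coh.{v, w} n M →+ Coh.{v, w} n (D.resFunctor.obj M) :=
  Coh.res D.toGroup n M

variable {M : TopRep.{max v w} ℤ G}

theorem hasContinuousAction_res (hM : Coh.HasContinuousAction.{v, w} M) :
    Coh.HasContinuousAction.{v, w} (D.resFunctor.obj M) :=
  Continuous.comp hM (((map_continuous D.toGroup).comp continuous_fst).prodMk continuous_snd)

theorem mem_invariants_of_res (hM : IsDiscreteModule.{v, w} M) {x : M}
    (hx : x ∈ Coh.invariants (D.resFunctor.obj M)) : x ∈ Coh.invariants M := by
  have := hM.1
  exact fun g =>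
    congr_fun (D.denseRange.equalizer (hM.continuous_apply x) continuous_const (funext hx)) g

theorem bijective_res_zero (hM : IsDiscreteModule.{v, w} M) :
    Function.Bijective (D.res.{v, w} 0 M) := by
  have h (x : Coh.{v, w} 0 M) :
      (Coh.zeroEquiv (D.resFunctor.obj M) (D.res 0 M x) : M) = Coh.zeroEquiv M x :=
    Coh.coe_zeroEquiv_pullback D.toGroup (𝟙 (D.resFunctor.obj M)) x
  refine ⟨fun x y hxy => (Coh.zeroEquiv M).injective (Subtype.ext ?_), fun y => ?_⟩
  · rw [← h, ← h, hxy]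
  · refine ⟨(Coh.zeroEquiv M).symm ⟨_, D.mem_invariants_of_res hM
      (Coh.zeroEquiv (D.resFunctor.obj M) y).2⟩, (Coh.zeroEquiv _).injective (Subtype.ext ?_)⟩
    rw [h, AddEquiv.apply_symm_apply]

/-! ### Invariants of the coinduced module of `C(G, M)` -/

section Invariants

theorem invariant_coind_coind₁_apply (f : Coh.invariants (D.coind (D.resFunctor.obj M.coind₁)))
    (w : W) (z : ℤ) : ((f.1 : ℤ → C(G, M)) z) (D.toGroup w) =
      M.ρ (D.toGroup w) (((f.1 : ℤ → C(G, M)) (z - D.deg w)) 1) := by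
  refine congr($((D.coe_invariant_coind f w z).symm) (D.toGroup w)).trans ?_
  change M.ρ (D.toGroup w) (((f.1 : ℤ → C(G, M)) (z - D.deg w)) ((D.toGroup w)⁻¹ * D.toGroup w)) = _
  rw [inv_mul_cancel]

theorem invariant_coind_coind₁_ext (hM : IsDiscreteModule.{v, w} M)
    {f f' : Coh.invariants (D.coind (D.resFunctor.obj M.coind₁))}
    (h : ∀ z, ((f.1 : ℤ → C(G, M)) z) 1 = ((f'.1 : ℤ → C(G, M)) z) 1) : f = f' := by
  have := hM.1
  refine Subtype.ext (funext fun z => DFunLike.coe_injective (F := C(G, M))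
    (D.denseRange.equalizer (map_continuous (F := C(G, M)) _) (map_continuous (F := C(G, M)) _)
      (funext fun w => ?_)))
  change ((f.1 : ℤ → C(G, M)) z) (D.toGroup w) = ((f'.1 : ℤ → C(G, M)) z) (D.toGroup w)
  rw [invariant_coind_coind₁_apply, invariant_coind_coind₁_apply, h]

theorem invariant_coind_mem_periodicFunctions [CompactSpace G] (hM : IsDiscreteModule.{v, w} M)
    (f : Coh.invariants (D.coind (D.resFunctor.obj M))) :
    (f.1 : ℤ → M) ∈ periodicFunctions M := by
  let S := Coh.stabilizer M ((f.1 : ℤ → M) 0)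
  have := S.quotient_finite_of_isOpen (hM.isOpen_stabilizer _)
  obtain ⟨m, hm, -, hmS⟩ := Subgroup.exists_pow_mem_of_index_ne_zero
    (S.finiteIndex_of_finite_quotient).index_ne_zero (D.toGroup D.gen)
  refine ⟨m, hm.ne', fun z => ?_⟩
  rw [D.invariant_coind_eq_gen f, D.invariant_coind_eq_gen f z, zpow_add, Coh.ρ_mul_apply,
    zpow_natCast]
  refine congr_arg ((D.resFunctor.obj M).ρ (D.gen ^ z)) ?_
  change M.ρ (D.toGroup (D.gen ^ m)) _ = _
  rw [map_pow]
  exact hmS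

/-- The function `z ↦ g ↦ g • u (z - χ g)`, where `χ : G → ℤ / m` extends the degree. -/
theorem exists_invariant_coind_coind₁ (hM : IsDiscreteModule.{v, w} M) {u : ℤ → M}
    (hu : u ∈ periodicFunctions M) :
    ∃ f : Coh.invariants (D.coind (D.resFunctor.obj M.coind₁)),
      ∀ z, ((f.1 : ℤ → C(G, M)) z) 1 = u z := by
  have := hM.1
  obtain ⟨m, hm, hu⟩ := hu
  obtain ⟨v, hv⟩ := exists_zmod_factorization hu
  obtain ⟨χ, hχ, hχ_mul, hχ_deg⟩ := D.exists_extension m hm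
  have hχ_one : χ 1 = 0 := by simpa using hχ_mul 1 1
  let f : ℤ → C(G, M) := fun z => ⟨fun g => M.ρ g (v (z - χ g)),
    hM.2.comp (continuous_id.prodMk (hχ.comp fun a => v (z - a)).continuous)⟩
  refine ⟨⟨f, fun w => funext fun z => ContinuousMap.ext fun g => ?_⟩, fun z => ?_⟩
  · change M.ρ (D.toGroup w) (M.ρ ((D.toGroup w)⁻¹ * g)
      (v ((z - D.deg w : ℤ) - χ ((D.toGroup w)⁻¹ * g)))) = M.ρ g (v (z - χ g))
    have hχ_inv : χ ((D.toGroup w)⁻¹ * g) = χ g - D.deg w := by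
      rw [← map_inv, hχ_mul, hχ_deg, D.deg_inv, Int.cast_neg, neg_add_eq_sub]
    rw [hχ_inv, Int.cast_sub, sub_sub_sub_cancel_right, ← Coh.ρ_mul_apply, mul_inv_cancel_left]
  · change M.ρ 1 (v (z - χ 1)) = u z
    rw [map_one, hχ_one, sub_zero, hv]
    rfl

variable [CompactSpace G]

/-- Evaluation at `1 ∈ G` identifies the invariants of `ℤ → C(G, M)` with the periodic functions
with values in `M`. -/
def invariantsEquiv (hM : IsDiscreteModule.{v, w} M) :
    Coh.invariants (D.coind (D.resFunctor.obj M.coind₁)) ≃+ periodicFunctions M :=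
  AddEquiv.ofBijective
    (AddMonoidHom.mk' (fun f => (⟨fun z => ((f.1 : ℤ → C(G, M)) z) 1, by
      obtain ⟨m, hm, hf⟩ := D.invariant_coind_mem_periodicFunctions hM.coind₁ f
      exact ⟨m, hm, fun z => congr($(hf z) 1)⟩⟩ : periodicFunctions M)) fun _ _ => rfl)
    ⟨fun _ _ h => D.invariant_coind_coind₁_ext hM fun z => congr_fun (congr_arg Subtype.val h) z,
      fun u => (D.exists_invariant_coind_coind₁ hM u.2).imp fun _ h => Subtype.ext (funext h)⟩

theorem invariantsEquiv_diff (hM : IsDiscreteModule.{v, w} M)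
    (f : Coh.invariants (D.coind (D.resFunctor.obj M.coind₁))) :
    D.invariantsEquiv hM (Coh.invariantsMap (D.diff _) f) =
      periodicDiff M (D.invariantsEquiv hM f) :=
  rfl

theorem mem_range_invariantsMap_diff_iff (hM : IsDiscreteModule.{v, w} M)
    (u : periodicFunctions M) :
    (D.invariantsEquiv hM).symm u ∈
        (Coh.invariantsMap (D.diff (D.resFunctor.obj M.coind₁))).range ↔
      u ∈ (periodicDiff M).range := by
  constructor
  · rintro ⟨f, hf⟩
    exact ⟨D.invariantsEquiv hM f, by rw [← invariantsEquiv_diff, hf, AddEquiv.apply_symm_apply]⟩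
  · rintro ⟨v, rfl⟩
    refine ⟨(D.invariantsEquiv hM).symm v, (D.invariantsEquiv hM).injective ?_⟩
    rw [invariantsEquiv_diff, AddEquiv.apply_symm_apply, AddEquiv.apply_symm_apply]

end Invariants

section Cohomology

variable [CompactSpace G] [LocallyCompactSpace W] (hM : IsDiscreteModule.{v, w} M)

/-- The connecting map of `0 → X → (ℤ → X) → (ℤ → X) → 0` for `X = C(G, M)`, which presents
`H^1(W, C(G, M))` as the periodic functions modulo differences. -/
def periodicδ : periodicFunctions M →+ Coh.{v, w} 1 (D.resFunctor.obj M.coind₁) :=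
  (D.topSplitExact_diff (D.hasContinuousAction_res hM.coind₁.2)).invariantδ.comp
    (D.invariantsEquiv hM).symm.toAddMonoidHom

theorem periodicδ_eq_zero_iff (u : periodicFunctions M) :
    D.periodicδ hM u = 0 ↔ u ∈ (periodicDiff M).range :=
  ((D.topSplitExact_diff (D.hasContinuousAction_res hM.coind₁.2)).invariantδ_eq_zero_iff _).trans
    (D.mem_range_invariantsMap_diff_iff hM u)

theorem periodicδ_surjective : Function.Surjective (D.periodicδ hM) :=
  have := D.subsingleton_coind M 0
  (D.topSplitExact_diff (D.hasContinuousAction_res hM.coind₁.2)).invariantδ_surjective.comp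
    (D.invariantsEquiv hM).symm.surjective

include hM

theorem bijective_nsmul_coh_one_coind₁ {k : ℕ} (hk : k ≠ 0) :
    Function.Bijective (nsmulAddMonoidHom (α := Coh.{v, w} 1 (D.resFunctor.obj M.coind₁)) k) := by
  refine ⟨(injective_iff_map_eq_zero _).2 fun x hx => ?_, fun x => ?_⟩
  · obtain ⟨f, rfl⟩ := D.periodicδ_surjective hM x
    rw [nsmulAddMonoidHom_apply, ← map_nsmul, periodicδ_eq_zero_iff] at hx
    exact (D.periodicδ_eq_zero_iff hM f).2 (mem_range_periodicDiff_of_nsmul hk hx)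
  · obtain ⟨f, rfl⟩ := D.periodicδ_surjective hM x
    obtain ⟨f', hf'⟩ := exists_sub_nsmul_mem_range_periodicDiff f hk
    rw [← D.periodicδ_eq_zero_iff hM, map_sub, map_nsmul, sub_eq_zero] at hf'
    exact ⟨_, hf'.symm⟩

theorem subsingleton_coh_add_two_coind₁ (n : ℕ) :
    Subsingleton (Coh.{v, w} (n + 2) (D.resFunctor.obj M.coind₁)) := by
  have h := D.topSplitExact_diff (D.hasContinuousAction_res hM.coind₁.2)
  have := D.subsingleton_coind M n
  have := D.subsingleton_coind M (n + 1)
  refine subsingleton_of_forall_eq 0 fun x => ?_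
  obtain ⟨y, rfl⟩ := (h.exact_δ_map (n + 1) x).1 (Subsingleton.elim _ _)
  rw [Subsingleton.elim y 0, map_zero]

theorem isAddTorsion_coh_one_coind :
    IsAddTorsion (Coh.{v, w} 1 (D.coind (D.resFunctor.obj M))) := by
  intro x
  have h := Coh.topSplitExact_shift hM.2
  have hJ := D.topSplitExact_coindMap (h.res D.toGroup)
  have := D.subsingleton_coind M 0
  obtain ⟨f, rfl⟩ := hJ.invariantδ_surjective x
  obtain ⟨r, s, -, hs, -⟩ := h.exists_splitting
  let f₀ : Coh.shift.{v, w} M := (f.1 : ℤ → Coh.shift.{v, w} M) 0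
  have hf₀ : ∀ g ∈ D.degHom.ker.map (D.toGroup : W →* G),
      Coh.toShift M (M.coind₁.ρ g (s f₀)) = Coh.toShift M (s f₀) := by
    rintro _ ⟨w, hw, rfl⟩
    rw [hom_comm_apply, hs]
    have hf := D.coe_invariant_coind f w 0
    rwa [show D.deg w = 0 from hw, sub_zero] at hf
  obtain ⟨k, b, hk, hb, hbc⟩ := hM.coind₁.exists_nsmul_invariant (Coh.toShift M) _ (s f₀) hf₀
  obtain ⟨F, hF⟩ := D.exists_invariant_coind (X := D.resFunctor.obj M.coind₁) (b := b)
    fun w hw => hb _ ⟨w, hw, rfl⟩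
  refine isOfFinAddOrder_iff_nsmul_eq_zero.2 ⟨k, hk, ?_⟩
  rw [← map_nsmul, hJ.invariantδ_eq_zero_iff]
  refine ⟨F, D.invariant_coind_ext ?_⟩
  change Coh.toShift M ((F.1 : ℤ → C(G, M)) 0) = k • f₀
  rw [hF, hbc, hs]

end Cohomology

end DegreeDatum

/-! ### Tensor products with `ℚ / ℤ` -/

section RatTensor

variable {L V T : Type*} [AddCommGroup L] [AddCommGroup V] [AddCommGroup T]

/-- The structure of `ℚ`-vector space on a uniquely divisible abelian group, transported from its
divisible hull. -/
abbrev moduleRatOfBijectiveNsmul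
    (hV : ∀ k : ℕ, k ≠ 0 → Function.Bijective (nsmulAddMonoidHom (α := V) k)) : Module ℚ V :=
  have : IsAddTorsionFree V := ⟨fun k hk => (hV k hk).1⟩
  (AddEquiv.ofBijective (DivisibleHull.coeAddMonoidHom V) ⟨DivisibleHull.coe_injective, fun x => by
    induction x with | mk v s => ?_
    obtain ⟨v, rfl⟩ := (hV s s.ne_zero).2 v
    exact ⟨v, DivisibleHull.mk_eq_mk_iff_smul_eq_smul.2 (one_nsmul _).symm⟩⟩).module ℚ

theorem exists_tmul_inv_natCast_eq (z : L ⊗[ℤ] AddCircle (1 : ℚ)) :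
    ∃ (x : L) (n : ℕ), n ≠ 0 ∧ x ⊗ₜ (((n : ℚ)⁻¹ : ℚ) : AddCircle (1 : ℚ)) = z := by
  have smul_tmul (x : L) (m : ℤ) (q : ℚ) : (m • x) ⊗ₜ[ℤ] (q : AddCircle (1 : ℚ)) =
      x ⊗ₜ ((m * q : ℚ) : AddCircle (1 : ℚ)) := by
    rw [TensorProduct.smul_tmul, ← AddCircle.coe_zsmul, zsmul_eq_mul]
  induction z with
  | zero => exact ⟨0, 1, one_ne_zero, TensorProduct.zero_tmul _ _⟩
  | tmul x q =>
    induction q using QuotientAddGroup.induction_on with | H q => ?_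
    refine ⟨q.num • x, q.den, q.den_nz, ?_⟩
    rw [smul_tmul, ← div_eq_mul_inv, Rat.num_div_den]
  | add a b ha hb =>
    obtain ⟨x, n, hn, rfl⟩ := ha
    obtain ⟨y, m, hm, rfl⟩ := hb
    refine ⟨(m : ℤ) • x + (n : ℤ) • y, n * m, mul_ne_zero hn hm, ?_⟩
    have hn' : (n : ℚ) ≠ 0 := Nat.cast_ne_zero.2 hn
    have hm' : (m : ℚ) ≠ 0 := Nat.cast_ne_zero.2 hm
    rw [TensorProduct.add_tmul, smul_tmul, smul_tmul]
    congr 4 <;> push_cast <;> field_simp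

theorem tmul_addCircle_eq_zero {x : L} (hx : IsOfFinAddOrder x) (q : AddCircle (1 : ℚ)) :
    x ⊗ₜ[ℤ] q = 0 := by
  obtain ⟨k, hk, hx⟩ := isOfFinAddOrder_iff_nsmul_eq_zero.1 hx
  induction q using QuotientAddGroup.induction_on with | H q => ?_
  have hk' : (k : ℚ) ≠ 0 := Nat.cast_ne_zero.2 hk.ne'
  have hq : (q : AddCircle (1 : ℚ)) = (k : ℤ) • ((q / k : ℚ) : AddCircle (1 : ℚ)) := by
    rw [← AddCircle.coe_zsmul, zsmul_eq_mul, Int.cast_natCast, mul_div_cancel₀ q hk']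
  rw [hq, ← TensorProduct.smul_tmul, natCast_zsmul, hx, TensorProduct.zero_tmul]

theorem nsmul_inv_natCast_addCircle (n : ℕ) :
    (n : ℤ) • (((n : ℚ)⁻¹ : ℚ) : AddCircle (1 : ℚ)) = 0 := by
  rcases eq_or_ne n 0 with rfl | hn
  · exact zero_smul _ _
  · rw [← AddCircle.coe_zsmul, zsmul_eq_mul, Int.cast_natCast,
      mul_inv_cancel₀ (Nat.cast_ne_zero.2 hn), AddCircle.coe_period]

theorem nsmul_tmul_inv_natCast (x : L) (n : ℕ) :
    (n • x) ⊗ₜ[ℤ] (((n : ℚ)⁻¹ : ℚ) : AddCircle (1 : ℚ)) = 0 := by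
  rw [← natCast_zsmul, TensorProduct.smul_tmul, nsmul_inv_natCast_addCircle,
    TensorProduct.tmul_zero]

theorem isAddTorsion_tensorProduct_addCircle : IsAddTorsion (L ⊗[ℤ] AddCircle (1 : ℚ)) := by
  intro z
  obtain ⟨x, n, hn, rfl⟩ := exists_tmul_inv_natCast_eq z
  refine isOfFinAddOrder_iff_nsmul_eq_zero.2 ⟨n, Nat.pos_of_ne_zero hn, ?_⟩
  rw [TensorProduct.smul_tmul', nsmul_tmul_inv_natCast]

variable [Module ℚ V]

theorem subsingleton_tensorProduct_addCircle {p : V →+ T}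
    (h : AddCommGroup.torsion T ⊔ p.range = ⊤) : Subsingleton (T ⊗[ℤ] AddCircle (1 : ℚ)) := by
  refine subsingleton_of_forall_eq 0 fun z => ?_
  obtain ⟨x, n, hn, rfl⟩ := exists_tmul_inv_natCast_eq z
  obtain ⟨t, ht, _, ⟨v, rfl⟩, rfl⟩ := AddSubgroup.mem_sup.1 (h ▸ AddSubgroup.mem_top x)
  have hv : n • (n : ℚ)⁻¹ • v = v := by
    rw [← Nat.cast_smul_eq_nsmul ℚ, smul_inv_smul₀ (Nat.cast_ne_zero.2 hn)]
  rw [TensorProduct.add_tmul, tmul_addCircle_eq_zero ht, ← hv, map_nsmul, nsmul_tmul_inv_natCast,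
    add_zero]

variable {i : L →+ V} {p : V →+ T} (h : Function.Exact i p)

/-- For `L → V → T` exact with `V` a `ℚ`-vector space, the map `L ⊗ ℚ / ℤ → T`,
`x ⊗ q ↦ p (q • i x)`. -/
def ratTensorMap : L ⊗[ℤ] AddCircle (1 : ℚ) →+ T :=
  TensorProduct.liftAddHom
    (AddMonoidHom.mk' (fun x => QuotientAddGroup.lift (AddSubgroup.zmultiples (1 : ℚ))
        (p.comp ((smulAddHom ℚ V).flip (i x))) (by
          rw [AddSubgroup.zmultiples_le]
          change p ((1 : ℚ) • i x) = 0
          rw [one_smul, h.apply_apply_eq_zero]))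
      fun x y => QuotientAddGroup.addMonoidHom_ext _ (AddMonoidHom.ext fun q => by
        change p (q • i (x + y)) = p (q • i x) + p (q • i y)
        rw [map_add, smul_add, map_add]))
    fun r x y => by rw [map_zsmul, map_zsmul]; rfl

theorem ratTensorMap_tmul (x : L) (q : ℚ) :
    ratTensorMap h (x ⊗ₜ (q : AddCircle (1 : ℚ))) = p (q • i x) :=
  rfl

theorem ratTensorMap_injective (hi : ∀ x, i x = 0 → IsOfFinAddOrder x) :
    Function.Injective (ratTensorMap h) := by
  rw [injective_iff_map_eq_zero]
  intro z hz
  obtain ⟨x, n, hn, rfl⟩ := exists_tmul_inv_natCast_eq z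
  obtain ⟨y, hy⟩ := (h _).1 ((ratTensorMap_tmul h _ _).symm.trans hz)
  have hxy : i (x - n • y) = 0 := by
    rw [map_sub, map_nsmul, hy, ← Nat.cast_smul_eq_nsmul ℚ, smul_inv_smul₀ (Nat.cast_ne_zero.2 hn),
      sub_self]
  rw [← sub_add_cancel x (n • y), TensorProduct.add_tmul, tmul_addCircle_eq_zero (hi _ hxy),
    nsmul_tmul_inv_natCast, add_zero]

theorem range_ratTensorMap :
    (ratTensorMap h).range = AddCommGroup.torsion T ⊓ p.range := by
  ext t
  constructor
  · rintro ⟨z, rfl⟩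
    refine ⟨(ratTensorMap h).isOfFinAddOrder (isAddTorsion_tensorProduct_addCircle z), ?_⟩
    obtain ⟨x, n, -, rfl⟩ := exists_tmul_inv_natCast_eq z
    exact ⟨_, (ratTensorMap_tmul h _ _).symm⟩
  · rintro ⟨ht, v, rfl⟩
    obtain ⟨n, hn, hv⟩ := isOfFinAddOrder_iff_nsmul_eq_zero.1 ht
    obtain ⟨x, hx⟩ := (h _).1 ((map_nsmul p n v).trans hv)
    refine ⟨x ⊗ₜ (((n : ℚ)⁻¹ : ℚ) : AddCircle (1 : ℚ)), ?_⟩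
    rw [ratTensorMap_tmul, hx, ← Nat.cast_smul_eq_nsmul ℚ,
      inv_smul_smul₀ (Nat.cast_ne_zero.2 hn.ne')]

theorem map_ratTensorMap {L' V' T' : Type*} [AddCommGroup L'] [AddCommGroup V'] [AddCommGroup T']
    [Module ℚ V'] {i' : L' →+ V'} {p' : V' →+ T'} (h' : Function.Exact i' p') {fL : L →+ L'}
    {fV : V →+ V'} {fT : T →+ T'} (hi : ∀ x, fV (i x) = i' (fL x)) (hp : ∀ v, fT (p v) = p' (fV v))
    (z : L ⊗[ℤ] AddCircle (1 : ℚ)) :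
    fT (ratTensorMap h z) = ratTensorMap h' (fL.toIntLinearMap.rTensor _ z) := by
  obtain ⟨x, n, -, rfl⟩ := exists_tmul_inv_natCast_eq z
  rw [LinearMap.rTensor_tmul, ratTensorMap_tmul, hp, map_rat_smul fV, hi]
  exact (ratTensorMap_tmul h' _ _).symm

end RatTensor

/-! ### Comparison of the cohomology of `G` and `W` -/

namespace DegreeDatum

open TopRep

variable {G W : Type v} [Group G] [TopologicalSpace G] [IsTopologicalGroup G]
  [Group W] [TopologicalSpace W] [IsTopologicalGroup W] (D : DegreeDatum G W)
  [CompactSpace G] [LocallyCompactSpace W] {M N : TopRep.{max v w} ℤ G}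
  (hM : IsDiscreteModule.{v, w} M) (hN : IsDiscreteModule.{v, w} N)

include hM

omit [LocallyCompactSpace W] in
theorem topSplitExact_res_shift :
    Coh.TopSplitExact.{v, w} (D.resFunctor.map (Coh.toCoind₁ M))
      (D.resFunctor.map (Coh.toShift M)) :=
  (Coh.topSplitExact_shift hM.2).res D.toGroup

/-- Up to sub- and quotient groups, `H^2(W, M)` is an extension of `H^1(W, ℤ → C(G, M) / M)` by
`H^1(W, ℤ → M)`, and both are torsion. -/
theorem isAddTorsion_coh_two : IsAddTorsion (Coh.{v, w} 2 (D.resFunctor.obj M)) := by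
  intro x
  have hD := D.topSplitExact_diff (D.hasContinuousAction_res hM.2)
  have hJ := D.topSplitExact_coindMap (D.topSplitExact_res_shift hM)
  have := D.subsingleton_coind M 1
  obtain ⟨y, hy⟩ := (hJ.exact_δ_map 1 (Coh.map 2 (D.toCoind _) x)).1 (Subsingleton.elim _ _)
  obtain ⟨k, hk, hky⟩ :=
    isOfFinAddOrder_iff_nsmul_eq_zero.1 (D.isAddTorsion_coh_one_coind hM.shift y)
  obtain ⟨z, hz⟩ := (hD.exact_δ_map 1 (k • x)).1
    (by rw [map_nsmul, ← hy, ← map_nsmul, hky, map_zero])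
  obtain ⟨l, hl, hlz⟩ := isOfFinAddOrder_iff_nsmul_eq_zero.1 (D.isAddTorsion_coh_one_coind hM z)
  refine isOfFinAddOrder_iff_nsmul_eq_zero.2 ⟨l * k, mul_pos hl hk, ?_⟩
  rw [mul_smul, ← hz, ← map_nsmul, hlz, map_zero]

theorem mem_range_res_one_iff (y : Coh.{v, w} 1 (D.resFunctor.obj M)) :
    y ∈ (D.res 1 M).range ↔ IsOfFinAddOrder y := by
  refine ⟨?_, fun hy => ?_⟩
  · rintro ⟨x, rfl⟩
    exact (D.res 1 M).isOfFinAddOrder (hM.isAddTorsion_coh_one x)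
  · have h := Coh.topSplitExact_shift hM.2
    have h' := D.topSplitExact_res_shift hM
    obtain ⟨k, hk, hy⟩ := isOfFinAddOrder_iff_nsmul_eq_zero.1 hy
    obtain ⟨c, rfl⟩ := (h'.exact_δ_map 0 y).1 <|
      (injective_iff_map_eq_zero _).1 (D.bijective_nsmul_coh_one_coind₁ hM hk.ne').1 _ <|
        (map_nsmul _ k y).symm.trans (by rw [hy, map_zero])
    obtain ⟨c, rfl⟩ := (D.bijective_res_zero hM.shift).2 c
    exact ⟨h.δ 0 c, h.res_δ D.toGroup 0 c⟩

theorem injective_res_one : Function.Injective (D.res.{v, w} 1 M) := by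
  have h := Coh.topSplitExact_shift hM.2
  have h' := D.topSplitExact_res_shift hM
  have := Coh.subsingleton_coind₁.{v, w} M 0
  rw [injective_iff_map_eq_zero]
  intro x hx
  obtain ⟨c, rfl⟩ := (h.exact_δ_map 0 x).1 (Subsingleton.elim _ _)
  obtain ⟨b, hb⟩ := (h'.exact_map_δ 0 _).1 ((h.res_δ D.toGroup 0 c).symm.trans hx)
  obtain ⟨b, rfl⟩ := (D.bijective_res_zero hM.coind₁).2 b
  refine (h.exact_map_δ 0 c).2 ⟨b, (D.bijective_res_zero hM.shift).1 ?_⟩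
  exact (Coh.res_map D.toGroup (Coh.toShift M) 0 b).trans hb

/-- The structure of `ℚ`-vector space on `H^1(W, C(G, M))`. -/
abbrev moduleRat : Module ℚ (Coh.{v, w} 1 (D.resFunctor.obj M.coind₁)) :=
  moduleRatOfBijectiveNsmul fun _ => D.bijective_nsmul_coh_one_coind₁ hM

/-- The homomorphism `H^1(W, M) ⊗ ℚ / ℤ → H^1(W, C(G, M) / M)` arising from the divisibility of
`H^1(W, C(G, M))`. -/
def tensorMap : Coh.{v, w} 1 (D.resFunctor.obj M) ⊗[ℤ] AddCircle (1 : ℚ) →+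
    Coh.{v, w} 1 (D.resFunctor.obj (Coh.shift M)) :=
  letI := D.moduleRat hM
  ratTensorMap ((D.topSplitExact_res_shift hM).exact_map_map 1)

theorem range_tensorMap : (D.tensorMap hM).range =
    AddCommGroup.torsion _ ⊓ (Coh.map.{v, w} 1 (D.resFunctor.map (Coh.toShift M))).range :=
  letI := D.moduleRat hM
  range_ratTensorMap _

theorem injective_tensorMap : Function.Injective (D.tensorMap hM) := by
  let := D.moduleRat hM
  refine ratTensorMap_injective _ fun x hx => ?_
  obtain ⟨c, rfl⟩ := ((D.topSplitExact_res_shift hM).exact_δ_map 0 x).1 hx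
  obtain ⟨c, rfl⟩ := (D.bijective_res_zero hM.shift).2 c
  have h := Coh.topSplitExact_shift hM.2
  exact (D.mem_range_res_one_iff hM _).1 ⟨h.δ 0 c, h.res_δ D.toGroup 0 c⟩

theorem tensorMap_mem_range_res (z : Coh.{v, w} 1 (D.resFunctor.obj M) ⊗[ℤ] AddCircle (1 : ℚ)) :
    D.tensorMap hM z ∈ (D.res 1 (Coh.shift M)).range :=
  (D.mem_range_res_one_iff hM.shift _).2 ((D.range_tensorMap hM).le ⟨z, rfl⟩).1

/-- The lift of `tensorMap` along the injection
`H^1(G, C(G, M) / M) → H^1(W, C(G, M) / M)`. -/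
def tensorLift : Coh.{v, w} 1 (D.resFunctor.obj M) ⊗[ℤ] AddCircle (1 : ℚ) →+
    Coh.{v, w} 1 (Coh.shift M) :=
  (AddMonoidHom.ofInjective (D.injective_res_one hM.shift)).symm.toAddMonoidHom.comp
    ((D.tensorMap hM).codRestrict _ (D.tensorMap_mem_range_res hM))

theorem res_tensorLift (z : Coh.{v, w} 1 (D.resFunctor.obj M) ⊗[ℤ] AddCircle (1 : ℚ)) :
    D.res 1 _ (D.tensorLift hM z) = D.tensorMap hM z :=
  congr_arg Subtype.val (AddEquiv.apply_symm_apply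
    (AddMonoidHom.ofInjective (D.injective_res_one hM.shift)) _)

/-- The homomorphism `H^1(W, M) ⊗ ℚ / ℤ → H^2(G, M)`. -/
def tensorδ : Coh.{v, w} 1 (D.resFunctor.obj M) ⊗[ℤ] AddCircle (1 : ℚ) →+ Coh.{v, w} 2 M :=
  ((Coh.topSplitExact_shift hM.2).δ 1).comp (D.tensorLift hM)

theorem injective_tensorδ : Function.Injective (D.tensorδ hM) := by
  rw [injective_iff_map_eq_zero]
  intro z hz
  have := Coh.subsingleton_coind₁.{v, w} M 0
  obtain ⟨b, hb⟩ := ((Coh.topSplitExact_shift hM.2).exact_map_δ 1 _).1 hz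
  refine (injective_iff_map_eq_zero _).1 (D.injective_tensorMap hM) z ?_
  rw [← res_tensorLift, ← hb, Subsingleton.elim b 0, map_zero, map_zero]

theorem exact_tensorδ_res : Function.Exact (D.tensorδ hM) (D.res.{v, w} 2 M) := by
  have h := Coh.topSplitExact_shift hM.2
  have h' := D.topSplitExact_res_shift hM
  intro y
  constructor
  · intro hy
    have := Coh.subsingleton_coind₁.{v, w} M 1
    obtain ⟨t, rfl⟩ := (h.exact_δ_map 1 y).1 (Subsingleton.elim _ _)
    have ht : D.res 1 _ t ∈ (D.tensorMap hM).range := by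
      rw [range_tensorMap]
      exact ⟨(D.mem_range_res_one_iff hM.shift _).1 ⟨t, rfl⟩,
        (h'.exact_map_δ 1 _).1 ((h.res_δ D.toGroup 1 t).symm.trans hy)⟩
    obtain ⟨z, hz⟩ := ht
    refine ⟨z, congr_arg (h.δ 1) (D.injective_res_one hM.shift ?_)⟩
    rw [res_tensorLift, hz]
  · rintro ⟨z, rfl⟩
    refine (h.res_δ D.toGroup 1 _).trans ((h'.exact_map_δ 1 _).2 ?_)
    change D.res 1 _ (D.tensorLift hM z) ∈ (Coh.map 1 (D.resFunctor.map (Coh.toShift M))).range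
    rw [res_tensorLift]
    exact ((D.range_tensorMap hM).le ⟨z, rfl⟩).2

theorem torsion_sup_range_map_toShift :
    AddCommGroup.torsion (Coh.{v, w} 1 (D.resFunctor.obj (Coh.shift M))) ⊔
      (Coh.map.{v, w} 1 (D.resFunctor.map (Coh.toShift M))).range = ⊤ := by
  have h' := D.topSplitExact_res_shift hM
  refine eq_top_iff.2 fun t _ => ?_
  obtain ⟨k, hk, hy⟩ := isOfFinAddOrder_iff_nsmul_eq_zero.1 (D.isAddTorsion_coh_two hM (h'.δ 1 t))
  obtain ⟨b, hb⟩ := (h'.exact_map_δ 1 _).1 ((map_nsmul _ k t).trans hy)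
  obtain ⟨b, rfl⟩ := (D.bijective_nsmul_coh_one_coind₁ hM hk.ne').2 b
  refine AddSubgroup.mem_sup.2 ⟨_, isOfFinAddOrder_iff_nsmul_eq_zero.2 ⟨k, hk, ?_⟩, _, ⟨b, rfl⟩,
    sub_add_cancel t _⟩
  rw [smul_sub, ← hb, ← map_nsmul, nsmulAddMonoidHom_apply, sub_self]

theorem surjective_res_two : Function.Surjective (D.res.{v, w} 2 M) := by
  have h := Coh.topSplitExact_shift hM.2
  have h' := D.topSplitExact_res_shift hM
  intro y
  have := D.subsingleton_coh_add_two_coind₁ hM 0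
  obtain ⟨t, rfl⟩ := (h'.exact_δ_map 1 y).1 (Subsingleton.elim _ _)
  obtain ⟨t, ht, b, hb, rfl⟩ := AddSubgroup.mem_sup.1
    (D.torsion_sup_range_map_toShift hM ▸ AddSubgroup.mem_top t)
  obtain ⟨t, rfl⟩ := (D.mem_range_res_one_iff hM.shift t).2 ht
  refine ⟨h.δ 1 t, ?_⟩
  rw [map_add, (h'.exact_map_δ 1 b).2 hb, add_zero]
  exact h.res_δ D.toGroup 1 t

theorem bijective_res_succ {n : ℕ}
    (h₀ : Subsingleton (Coh.{v, w} n (D.resFunctor.obj M.coind₁)))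
    (h₁ : Subsingleton (Coh.{v, w} (n + 1) (D.resFunctor.obj M.coind₁)))
    (hn : Function.Bijective (D.res.{v, w} n (Coh.shift M))) :
    Function.Bijective (D.res.{v, w} (n + 1) M) := by
  have h := Coh.topSplitExact_shift hM.2
  have h' := D.topSplitExact_res_shift hM
  constructor
  · rw [injective_iff_map_eq_zero]
    intro x hx
    have := Coh.subsingleton_coind₁.{v, w} M n
    obtain ⟨c, rfl⟩ := (h.exact_δ_map n x).1 (Subsingleton.elim _ _)
    obtain ⟨b, hb⟩ := (h'.exact_map_δ n _).1 ((h.res_δ D.toGroup n c).symm.trans hx)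
    rw [Subsingleton.elim b 0, map_zero] at hb
    rw [(injective_iff_map_eq_zero _).1 hn.1 c hb.symm, map_zero]
  · intro y
    obtain ⟨c, rfl⟩ := (h'.exact_δ_map n y).1 (Subsingleton.elim _ _)
    obtain ⟨c, rfl⟩ := hn.2 c
    exact ⟨h.δ n c, h.res_δ D.toGroup n c⟩

theorem injective_res_two_shift : Function.Injective (D.res.{v, w} 2 (Coh.shift M)) := by
  let := D.moduleRat hM
  have := subsingleton_tensorProduct_addCircle (D.torsion_sup_range_map_toShift hM)
  rw [injective_iff_map_eq_zero]
  intro x hx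
  obtain ⟨z, rfl⟩ := (D.exact_tensorδ_res hM.shift x).1 hx
  rw [Subsingleton.elim z 0, map_zero]

theorem bijective_res_add_three (n : ℕ) : Function.Bijective (D.res.{v, w} (n + 3) M) := by
  induction n generalizing M with
  | zero =>
    exact D.bijective_res_succ hM (D.subsingleton_coh_add_two_coind₁ hM 0)
      (D.subsingleton_coh_add_two_coind₁ hM 1)
      ⟨D.injective_res_two_shift hM, D.surjective_res_two hM.shift⟩
  | succ n ih =>
    exact D.bijective_res_succ hM (D.subsingleton_coh_add_two_coind₁ hM (n + 1))
      (D.subsingleton_coh_add_two_coind₁ hM (n + 2)) (ih hM.shift)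

include hN

theorem map_tensorMap (f : M ⟶ N)
    (z : Coh.{v, w} 1 (D.resFunctor.obj M) ⊗[ℤ] AddCircle (1 : ℚ)) :
    Coh.map.{v, w} 1 (D.resFunctor.{v, w}.map (Coh.shiftMap.{v, w} f)) (D.tensorMap hM z) =
      D.tensorMap hN ((Coh.map.{v, w} 1 (D.resFunctor.map f)).toIntLinearMap.rTensor _ z) := by
  let := D.moduleRat hM
  let := D.moduleRat hN
  refine map_ratTensorMap _ _ (fL := Coh.map 1 (D.resFunctor.map f))
    (fV := Coh.map 1 (D.resFunctor.map (Coh.coind₁Map f)))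
    (fT := Coh.map 1 (D.resFunctor.map (Coh.shiftMap f)))
    (fun x => ?_) (fun x => ?_) z
  · rw [Coh.map_map, Coh.map_map, ← Functor.map_comp, Coh.toCoind₁_coind₁Map, Functor.map_comp]
  · rw [Coh.map_map, Coh.map_map, ← Functor.map_comp, Coh.toShift_shiftMap, Functor.map_comp]

theorem map_tensorδ (f : M ⟶ N)
    (z : Coh.{v, w} 1 (D.resFunctor.obj M) ⊗[ℤ] AddCircle (1 : ℚ)) :
    Coh.map 2 f (D.tensorδ hM z) = D.tensorδ hN
      ((Coh.map.{v, w} 1 (D.resFunctor.map f)).toIntLinearMap.rTensor _ z) := by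
  have hf : Coh.map 1 (Coh.shiftMap f) (D.tensorLift hM z) = D.tensorLift hN
      ((Coh.map.{v, w} 1 (D.resFunctor.map f)).toIntLinearMap.rTensor _ z) := by
    refine D.injective_res_one hN.shift ((Coh.res_map D.toGroup (Coh.shiftMap f) 1 _).trans ?_)
    rw [D.res_tensorLift hN, ← D.map_tensorMap hM hN f]
    exact congr_arg _ (D.res_tensorLift hM z)
  refine Eq.trans ?_ (congr_arg ((Coh.topSplitExact_shift hN.2).δ 1) hf)
  exact (Coh.topSplitExact_shift hM.2).map_δ (Coh.topSplitExact_shift hN.2) f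
    (Coh.coind₁Map f) (Coh.shiftMap f) (Coh.toCoind₁_coind₁Map f) (Coh.toShift_shiftMap f) 1 _

end DegreeDatum

/-! ### Degree data from a quotient isomorphic to `Ẑ` -/

open Topology

section Procyclic

/-- `Φ` topologically generates `Γ` and its powers are separated by open subgroups as the integers
are in the profinite completion `Ẑ`; for a profinite group `Γ` this means that `1 ↦ Φ` extends to
an isomorphism `Ẑ ≃ Γ`. -/
structure IsFreeTopologicalGenerator {Γ : Type*} [Group Γ] [TopologicalSpace Γ] (Φ : Γ) :
    Prop where
  dense_zpowers : Dense (Subgroup.zpowers Φ : Set Γ)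
  exists_isOpen : ∀ m : ℕ, m ≠ 0 →
    ∃ U : Subgroup Γ, IsOpen (U : Set Γ) ∧ ∀ k : ℤ, Φ ^ k ∈ U ↔ (m : ℤ) ∣ k

variable {Γ : Type*} [Group Γ] [TopologicalSpace Γ] [IsTopologicalGroup Γ] {Φ : Γ}

omit [IsTopologicalGroup Γ] in
theorem IsFreeTopologicalGenerator.zpow_injective (hΦ : IsFreeTopologicalGenerator Φ) :
    Function.Injective fun k : ℤ => Φ ^ k := by
  refine injective_zpow_iff_not_isOfFinOrder.2 fun hfin => ?_
  obtain ⟨U, -, hU⟩ := hΦ.exists_isOpen (2 * orderOf Φ) (by simpa using hfin.orderOf_pos.ne')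
  have hdvd : ((2 * orderOf Φ : ℕ) : ℤ) ∣ orderOf Φ :=
    (hU _).1 (by rw [zpow_natCast, pow_orderOf_eq_one]; exact U.one_mem)
  have hle := Nat.le_of_dvd hfin.orderOf_pos (Int.natCast_dvd_natCast.1 hdvd)
  have hpos := hfin.orderOf_pos
  omega

theorem exists_inv_mul_zpow_mem_of_isOpen (hΦ : Dense (Subgroup.zpowers Φ : Set Γ))
    {U : Subgroup Γ} (hU : IsOpen (U : Set Γ)) (x : Γ) : ∃ k : ℤ, x⁻¹ * Φ ^ k ∈ U := by
  obtain ⟨_, hy, ⟨k, rfl⟩⟩ := hΦ.inter_open_nonempty ((fun y => x⁻¹ * y) ⁻¹' (U : Set Γ))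
    (hU.preimage (continuous_const_mul _)) ⟨x, by simp [U.one_mem]⟩
  exact ⟨k, hy⟩

theorem IsFreeTopologicalGenerator.exists_isLocallyConstant_zmod
    (hΦ : IsFreeTopologicalGenerator Φ) {m : ℕ} (hm : m ≠ 0) :
    ∃ χ : Γ → ZMod m, IsLocallyConstant χ ∧ (∀ x y, χ (x * y) = χ x + χ y) ∧
      ∀ k : ℤ, χ (Φ ^ k) = k := by
  obtain ⟨U, hU, hUΦ⟩ := hΦ.exists_isOpen m hm
  choose k hk using exists_inv_mul_zpow_mem_of_isOpen hΦ.dense_zpowers hU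
  have hk_eq {x y : Γ} {l : ℤ} (hxy : x⁻¹ * y ∈ U) (hyl : y⁻¹ * Φ ^ l ∈ U) :
      (k x : ZMod m) = l := by
    rw [ZMod.intCast_eq_intCast_iff_dvd_sub, ← hUΦ]
    convert U.mul_mem (U.inv_mem (hk x)) (U.mul_mem hxy hyl) using 1
    rw [sub_eq_neg_add, zpow_add, zpow_neg]
    group
  have hconst : IsLocallyConstant fun x => (k x : ZMod m) :=
    (IsLocallyConstant.iff_exists_open _).2 fun x => ⟨(fun y => x⁻¹ * y) ⁻¹' (U : Set Γ),
      hU.preimage (continuous_const_mul _), by simp [U.one_mem], fun y hy => (hk_eq hy (hk y)).symm⟩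
  have hzpow (l : ℤ) : (k (Φ ^ l) : ZMod m) = l :=
    hk_eq (y := Φ ^ l) (by simp [U.one_mem]) (by simp [U.one_mem])
  refine ⟨fun x => k x, hconst, fun x y => ?_, hzpow⟩
  have hdense : Dense (Subgroup.zpowers Φ ×ˢ Subgroup.zpowers Φ : Set (Γ × Γ)) :=
    hΦ.dense_zpowers.prod hΦ.dense_zpowers
  refine congr_fun (Continuous.ext_on (f := fun p : Γ × Γ => (k (p.1 * p.2) : ZMod m))
    (g := fun p => k p.1 + k p.2) hdense (hconst.continuous.comp continuous_mul)
    ((hconst.continuous.comp continuous_fst).add (hconst.continuous.comp continuous_snd)) ?_) (x, y)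
  rintro ⟨_, _⟩ ⟨⟨a, rfl⟩, ⟨b, rfl⟩⟩
  change (k (Φ ^ a * Φ ^ b) : ZMod m) = k (Φ ^ a) + k (Φ ^ b)
  rw [← zpow_add, hzpow, hzpow, hzpow, Int.cast_add]

end Procyclic

section Profinite

variable {G : Type*} [Group G] [TopologicalSpace G] [IsTopologicalGroup G] [CompactSpace G]

theorem eq_one_of_forall_mem_openNormalSubgroup [TotallyDisconnectedSpace G] {x : G}
    (h : ∀ V : OpenNormalSubgroup G, x ∈ V) : x = 1 := by
  by_contra hx
  obtain ⟨V, hV⟩ := ProfiniteGrp.exist_openNormalSubgroup_sub_open_nhds_of_one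
    (isOpen_compl_singleton (x := x)) (show (1 : G) ∈ ({x}ᶜ : Set G) from fun h => hx h.symm)
  exact hV (h V) rfl

theorem exists_zpow_mem_openNormalSubgroup (V : OpenNormalSubgroup G) :
    ∃ m : ℕ, m ≠ 0 ∧ ∀ (x : G) (k : ℤ), (m : ℤ) ∣ k → x ^ k ∈ V := by
  have := V.toSubgroup.quotient_finite_of_isOpen V.isOpen
  have : V.toSubgroup.FiniteIndex := V.toSubgroup.finiteIndex_of_finite_quotient
  refine ⟨V.toSubgroup.index, Subgroup.FiniteIndex.index_ne_zero, fun x k ⟨l, hl⟩ => ?_⟩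
  rw [hl, zpow_mul, zpow_natCast]
  exact V.toSubgroup.zpow_mem (Subgroup.pow_index_mem _ x) l

variable {Γ : Type*} [Group Γ] [TopologicalSpace Γ]

theorem isOpenMap_of_surjective [T2Space Γ] (pr : G →ₜ* Γ)
    (hpr : Function.Surjective pr) : IsOpenMap pr :=
  (MonoidHom.isOpenQuotientMap_of_isQuotientMap
    (pr.continuous_toFun.isClosedMap.isQuotientMap pr.continuous_toFun hpr)).isOpenMap

variable (pr : G →ₜ* Γ) {Φ : Γ} {t : G}

theorem IsFreeTopologicalGenerator.eq_one_of_mem_topologicalClosure [TotallyDisconnectedSpace G]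
    (hΦ : IsFreeTopologicalGenerator Φ) (ht : pr t = Φ) {x : G}
    (hx : x ∈ (Subgroup.zpowers t).topologicalClosure) (hprx : pr x = 1) : x = 1 := by
  refine eq_one_of_forall_mem_openNormalSubgroup fun V => ?_
  obtain ⟨m, hm, hmV⟩ := exists_zpow_mem_openNormalSubgroup V
  obtain ⟨U, hU, hUΦ⟩ := hΦ.exists_isOpen m hm
  obtain ⟨_, ⟨hkV, hkU⟩, ⟨k, rfl⟩⟩ := mem_closure_iff.1 hx
    ((fun y => x * y⁻¹) ⁻¹' (V : Set G) ∩ pr ⁻¹' (U : Set Γ))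
    ((V.isOpen.preimage (continuous_const.mul continuous_inv)).inter
      (hU.preimage pr.continuous_toFun))
    ⟨by simp, by simp [hprx, U.one_mem]⟩
  have hmk : (m : ℤ) ∣ k := by
    rwa [Set.mem_preimage, map_zpow, ht, SetLike.mem_coe, hUΦ] at hkU
  exact inv_mul_cancel_right x (t ^ k) ▸ V.toSubgroup.mul_mem hkV (hmV t k hmk)

theorem IsFreeTopologicalGenerator.exists_splitting [TotallyDisconnectedSpace G] [T2Space Γ]
    (hΦ : IsFreeTopologicalGenerator Φ) (ht : pr t = Φ) :
    ∃ s : Γ →ₜ* G, s Φ = t ∧ ∀ x, pr (s x) = x := by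
  let C := (Subgroup.zpowers t).topologicalClosure
  have : CompactSpace C :=
    isCompact_iff_compactSpace.1 (Subgroup.isClosed_topologicalClosure _).isCompact
  let p : C →* Γ := (pr : G →* Γ).comp C.subtype
  have hp : Continuous p := pr.continuous_toFun.comp continuous_subtype_val
  have hp_inj : Function.Injective p := (injective_iff_map_eq_one p).2 fun x hx =>
    Subtype.ext (hΦ.eq_one_of_mem_topologicalClosure pr ht x.2 hx)
  have hp_surj : Function.Surjective p := by
    have hle : (Subgroup.zpowers Φ : Set Γ) ⊆ Set.range p := by
      rintro _ ⟨k, rfl⟩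
      exact ⟨⟨t ^ k, Subgroup.le_topologicalClosure _ ⟨k, rfl⟩⟩, by simp [p, ht]⟩
    refine Set.range_eq_univ.1 (Set.eq_univ_of_univ_subset ?_)
    rw [← hΦ.dense_zpowers.closure_eq]
    exact closure_minimal hle (isCompact_range hp).isClosed
  let e : C ≃* Γ := MulEquiv.ofBijective p ⟨hp_inj, hp_surj⟩
  let s : Γ →ₜ* G :=
    { toMonoidHom := C.subtype.comp e.symm.toMonoidHom
      continuous_toFun := continuous_subtype_val.comp (hp.continuous_symm_of_equiv_compact_to_t2
        (f := e.toEquiv)) }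
  refine ⟨s, ?_, e.apply_symm_apply⟩
  exact congr_arg Subtype.val (e.symm_apply_eq.2 (show Φ = pr t from ht.symm) : e.symm Φ =
    ⟨t, Subgroup.le_topologicalClosure _ (Subgroup.mem_zpowers t)⟩)

end Profinite

theorem continuous_of_isOpen_fiber_zero {W A : Type*} [Group W] [TopologicalSpace W]
    [IsTopologicalGroup W] [AddGroup A] [TopologicalSpace A] {deg : W → A}
    (hmul : ∀ a b, deg (a * b) = deg a + deg b) (hopen : IsOpen {w | deg w = 0}) :
    Continuous deg := by
  have h_one : deg 1 = 0 := by simpa using hmul 1 1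
  refine ((IsLocallyConstant.iff_exists_open _).2 fun w => ⟨(w⁻¹ * ·) ⁻¹' {w | deg w = 0},
    hopen.preimage (continuous_const_mul _), by simp [h_one], fun w' hw' => ?_⟩).continuous
  rw [← mul_inv_cancel_left w w', hmul, show deg (w⁻¹ * w') = 0 from hw', add_zero]

theorem IsFreeTopologicalGenerator.exists_degree {W Γ : Type*} [Group W] [TopologicalSpace W]
    [IsTopologicalGroup W] [Group Γ] [TopologicalSpace Γ] {Φ : Γ}
    (hΦ : IsFreeTopologicalGenerator Φ) (f : W →* Γ) (hf : ∀ w, f w ∈ Subgroup.zpowers Φ)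
    (hopen : IsOpen (f.ker : Set W)) :
    ∃ deg : W → ℤ, (∀ a b, deg (a * b) = deg a + deg b) ∧ Continuous deg ∧
      ∀ w, Φ ^ deg w = f w := by
  choose deg hdeg using hf
  replace hdeg (w : W) : Φ ^ deg w = f w := hdeg w
  have hmul (a b : W) : deg (a * b) = deg a + deg b :=
    hΦ.zpow_injective (by simp only [hdeg, map_mul, zpow_add])
  refine ⟨deg, hmul, continuous_of_isOpen_fiber_zero hmul ?_, hdeg⟩
  convert hopen using 1
  ext w
  rw [SetLike.mem_coe, MonoidHom.mem_ker, ← hdeg, ← zpow_zero Φ]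
  exact hΦ.zpow_injective.eq_iff.symm

/-- The hypotheses describe `W` as the Weil group of the extension `pr : G → Γ`: the preimage of
the powers of `Φ`, with the topology for which the kernel of `pr` is an open topological subgroup.
The extension splits over `Γ ≃ Ẑ`, and `kerPart` is the projection to the kernel along a
splitting. -/
theorem exists_degreeDatum {G W : Type v} {Γ : Type*} [Group G] [TopologicalSpace G]
    [IsTopologicalGroup G] [CompactSpace G] [TotallyDisconnectedSpace G] [Group Γ]
    [TopologicalSpace Γ] [IsTopologicalGroup Γ] [T2Space Γ] [Group W] [TopologicalSpace W]
    [IsTopologicalGroup W] (pr : G →ₜ* Γ) (hpr : Function.Surjective pr) {Φ : Γ}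
    (hΦ : IsFreeTopologicalGenerator Φ) (j : W →ₜ* G) (hj : Function.Injective j)
    (hrange : Set.range j = pr ⁻¹' Subgroup.zpowers Φ) (hopen : IsOpen {w | pr (j w) = 1})
    (hinducing : IsInducing fun w : {w // pr (j w) = 1} => j w) :
    ∃ D : DegreeDatum G W, D.toGroup = j := by
  have hlift {g : G} (hg : pr g ∈ Subgroup.zpowers Φ) : ∃ w, j w = g :=
    hrange.symm.subset hg
  obtain ⟨deg, hdeg_mul, hdeg_cont, hdeg⟩ := hΦ.exists_degree (pr.comp j : W →* Γ)
    (fun w => hrange.subset ⟨w, rfl⟩) hopen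
  replace hdeg (w : W) : Φ ^ deg w = pr (j w) := hdeg w
  obtain ⟨t₀, ht₀⟩ := hpr Φ
  obtain ⟨t, rfl⟩ := hlift (g := t₀) (ht₀ ▸ Subgroup.mem_zpowers _)
  obtain ⟨s, hsΦ, hs⟩ := hΦ.exists_splitting pr ht₀
  have hpr_ker (g : G) : pr (g * (s (pr g))⁻¹) = 1 := by
    rw [map_mul, map_inv, hs, mul_inv_cancel]
  choose ker hker using fun g => hlift (hpr_ker g ▸ Subgroup.one_mem (Subgroup.zpowers Φ))
  have hker_cont : Continuous ker := by
    have h : Continuous fun g => (⟨ker g, by rw [hker, hpr_ker]⟩ : {w // pr (j w) = 1}) :=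
      hinducing.continuous_iff.2 ((continuous_id.mul (map_continuous (s.comp pr)).inv).congr
        fun g => (hker g).symm)
    exact continuous_subtype_val.comp h
  refine ⟨{ toGroup := j, deg := deg, deg_mul := hdeg_mul, continuous_deg := hdeg_cont, gen := t
            denseRange := ?_, deg_gen := ?_, kerPart := ⟨ker, hker_cont⟩
            kerPart_mul := fun w g => hj ?_, exists_extension := fun m hm => ?_ }, rfl⟩
  · rw [DenseRange, hrange]
    exact hΦ.dense_zpowers.preimage (isOpenMap_of_surjective pr hpr)
  · exact hΦ.zpow_injective (by simpa only [zpow_one, ht₀] using hdeg t)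
  · change j (ker (j w * g)) = j (w * ker g * t ^ (-deg w))
    simp only [hker, map_mul, map_inv, map_zpow, ← hdeg, hsΦ, mul_inv_rev, zpow_neg, mul_assoc]
  · obtain ⟨χ, hχ, hχ_mul, hχΦ⟩ := hΦ.exists_isLocallyConstant_zmod hm
    refine ⟨χ ∘ pr, hχ.comp_continuous pr.continuous_toFun, fun a b => ?_, fun w => ?_⟩
    · rw [Function.comp_apply, map_mul, hχ_mul]; rfl
    · rw [Function.comp_apply, ← hdeg, hχΦ]

/-! ### Integral closures in algebraic extensions of a local field -/

section SpectralNorm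

variable {R K L : Type*} [NontriviallyNormedField K] [IsUltrametricDist K] [CommRing R]
  [IsDomain R] [IsIntegrallyClosed R] [Algebra R K] [IsFractionRing R K] [Field L] [Algebra K L]
  [Algebra R L] [IsScalarTower R K L] [Algebra.IsAlgebraic K L]

omit [IsUltrametricDist K] in
theorem isIntegral_iff_spectralNorm_le_one
    (h : ∀ x : K, ‖x‖ ≤ 1 ↔ x ∈ Set.range (algebraMap R K)) {x : L} :
    IsIntegral R x ↔ spectralNorm K L x ≤ 1 := by
  have hx : IsIntegral K x := Algebra.IsIntegral.isIntegral x
  rw [spectralNorm, spectralValue_le_one_iff (minpoly.monic hx)]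
  constructor
  · intro hxR n
    rw [minpoly.isIntegrallyClosed_eq_field_fractions' K hxR, Polynomial.coeff_map, h]
    exact ⟨_, rfl⟩
  · intro hn
    have hlifts : minpoly K x ∈ Polynomial.lifts (algebraMap R K) :=
      (Polynomial.lifts_iff_coeff_lifts _).2 fun n => (h _).1 (hn n)
    obtain ⟨p, hp, -, hpm⟩ := Polynomial.lifts_and_natDegree_eq_and_monic hlifts (minpoly.monic hx)
    refine ⟨p, hpm, ?_⟩
    rw [IsScalarTower.algebraMap_eq R K L, ← Polynomial.eval₂_map, hp]
    exact minpoly.aeval K x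

theorem mem_nonunits_integralClosure_iff_spectralNorm_lt_one [CompleteSpace K]
    (h : ∀ x : K, ‖x‖ ≤ 1 ↔ x ∈ Set.range (algebraMap R K)) {x : integralClosure R L} :
    x ∈ nonunits (integralClosure R L) ↔ spectralNorm K L x < 1 := by
  have hmul (a b : L) : spectralNorm K L (a * b) = spectralNorm K L a * spectralNorm K L b :=
    map_mul (spectralMulAlgNorm K L) a b
  have hone : spectralNorm K L (1 : L) = 1 := map_one (spectralMulAlgNorm K L)
  have hle (a : integralClosure R L) : spectralNorm K L a ≤ 1 :=
    (isIntegral_iff_spectralNorm_le_one h).1 a.2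
  constructor
  · refine fun hx => (hle x).lt_of_ne fun hx_one => hx ?_
    have hx₀ : (x : L) ≠ 0 := fun h₀ => by simp [h₀, spectralNorm_zero] at hx_one
    have hinv : spectralNorm K L (x : L)⁻¹ = 1 := by
      rw [← one_mul (spectralNorm K L _), ← hx_one, ← hmul, mul_inv_cancel₀ hx₀, hone, hx_one]
    exact .of_mul_eq_one ⟨(x : L)⁻¹, (isIntegral_iff_spectralNorm_le_one h).2 hinv.le⟩
      (Subtype.ext (mul_inv_cancel₀ hx₀))
  · rintro hx_lt hx
    obtain ⟨u, hu⟩ := hx.exists_right_inv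
    have hlt := mul_lt_one_of_nonneg_of_lt_one_left (spectralNorm_nonneg _) hx_lt (hle u)
    rw [← hmul, ← Subalgebra.coe_mul, hu, Subalgebra.coe_one, hone] at hlt
    exact lt_irrefl _ hlt

theorem isLocalRing_integralClosure_of_norm [CompleteSpace K]
    (h : ∀ x : K, ‖x‖ ≤ 1 ↔ x ∈ Set.range (algebraMap R K)) :
    IsLocalRing (integralClosure R L) := by
  refine IsLocalRing.of_nonunits_add fun a b ha hb => ?_
  rw [mem_nonunits_integralClosure_iff_spectralNorm_lt_one h] at ha hb ⊢
  exact (isNonarchimedean_spectralNorm (K := K) (a : L) (b : L)).trans_lt (max_lt ha hb)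

end SpectralNorm

instance isLocalRing_integralClosure (K : Type*) [Field K] [ValuativeRel K] [TopologicalSpace K]
    [IsNonarchimedeanLocalField K] (L : Type*) [Field L] [Algebra K L] [Algebra.IsAlgebraic K L] :
    IsLocalRing (integralClosure 𝒪[K] L) := by
  let := IsTopologicalAddGroup.rightUniformSpace K
  have := isUniformAddGroup_of_addCommGroup (G := K)
  have : CompleteSpace K := inferInstance
  let : (Valued.v (R := K) (Γ₀ := ValueGroupWithZero K)).RankOne :=
    { hom' := IsRankLeOne.nonempty.some.emb (R := K).comp MonoidWithZeroHom.ValueGroup₀.embedding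
      strictMono' := IsRankLeOne.nonempty.some.strictMono.comp
        MonoidWithZeroHom.ValueGroup₀.embedding_strictMono }
  let := Valued.toNontriviallyNormedField (L := K) (Γ₀ := ValueGroupWithZero K)
  refine isLocalRing_integralClosure_of_norm (K := K) fun x => ?_
  rw [Valued.toNormedField.norm_le_one_iff]
  exact ⟨fun h => ⟨⟨x, h⟩, rfl⟩, fun ⟨y, hy⟩ => hy ▸ y.2⟩

theorem algHom_ext_of_formallyUnramified {R A B : Type*} [CommRing R] [CommRing A] [IsDomain A]
    [CommRing B] [Algebra R A] [Algebra R B] [Algebra.FormallyUnramified R B]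
    [Algebra.EssFiniteType R B] {f g : B →ₐ[R] A} {Q : Ideal A} (hQ : Q ≠ ⊤)
    (h : ∀ b, f b - g b ∈ Q) : f = g := by
  -- The unramified element `e : B ⊗[R] B` satisfies `μ e = 1` and `(1 ⊗ b - b ⊗ 1) * e = 0`.
  -- Since `f ⊗ g` agrees with `f ∘ μ` modulo `Q`, it does not kill `e`, hence it kills every
  -- `1 ⊗ b - b ⊗ 1`.
  let F : B ⊗[R] B →ₐ[R] A := Algebra.TensorProduct.lift f g fun _ _ => .all _ _
  have hF : (Ideal.Quotient.mkₐ R Q).comp F =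
      ((Ideal.Quotient.mkₐ R Q).comp f).comp (Algebra.TensorProduct.lmul' R) := by
    refine Algebra.TensorProduct.ext' fun a b => ?_
    have hfg : Ideal.Quotient.mkₐ R Q (f b) = Ideal.Quotient.mkₐ R Q (g b) :=
      Ideal.Quotient.eq.2 (h b)
    simp only [F, AlgHom.comp_apply, Algebra.TensorProduct.lift_tmul, map_mul,
      Algebra.TensorProduct.lmul'_apply_tmul, hfg]
  have hF_elem : F (Algebra.FormallyUnramified.elem R B) ≠ 0 := fun h₀ => by
    have helem := congr($hF (Algebra.FormallyUnramified.elem R B))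
    rw [AlgHom.comp_apply, AlgHom.comp_apply, Algebra.FormallyUnramified.lmul_elem, h₀, map_zero,
      map_one] at helem
    have := Ideal.Quotient.nontrivial_iff.2 hQ
    exact zero_ne_one helem
  ext b
  have hb := congr_arg F (Algebra.FormallyUnramified.one_tmul_sub_tmul_one_mul_elem (R := R) b)
  rw [map_mul, map_zero, map_sub] at hb
  have hgf := (mul_eq_zero.1 hb).resolve_right hF_elem
  simp only [F, Algebra.TensorProduct.lift_tmul, map_one, one_mul, mul_one] at hgf
  exact (sub_eq_zero.1 hgf).symm

/-! ### The action of the Galois group on the residue field -/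

section Frobenius

theorem exists_algHom_apply_eq_pow_card {k l : Type*} [Field k] [Finite k] [Field l] [Algebra k l]
    [Algebra.IsAlgebraic k l] (τ : l →ₐ[k] l) (s : Finset l) :
    ∃ n : ℕ, ∀ x ∈ s, τ x = x ^ Nat.card k ^ n := by
  let k' := IntermediateField.adjoin k (s : Set l)
  have : FiniteDimensional k k' := IntermediateField.finiteDimensional_adjoin fun x _ =>
    Algebra.IsIntegral.isIntegral x
  have : Finite k' := Module.finite_of_finite k
  have := Fintype.ofFinite k
  obtain ⟨n, hn⟩ := (FiniteField.bijective_frobeniusAlgEquivOfAlgebraic_pow k k').2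
    (AlgEquiv.ofBijective (τ.restrictNormal k') (AlgHom.bijective _))
  refine ⟨n, fun x hx => ?_⟩
  have hτx := congr((($hn ⟨x, IntermediateField.subset_adjoin k _ hx⟩ : k') : l))
  rw [AlgEquiv.coe_ofBijective, AlgEquiv.coe_pow,
    FiniteField.coe_frobeniusAlgEquivOfAlgebraic_iterate] at hτx
  refine ((AlgHom.restrictNormal_commutes τ k' _).symm.trans hτx.symm).trans ?_
  rw [Nat.card_eq_fintype_card]
  rfl

theorem isArithFrobAt_pow_apply_sub_mem {A B : Type*} [CommRing A] [CommRing B] [Algebra A B]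
    {φ : B →ₐ[A] B} {Q : Ideal B} (h : φ.IsArithFrobAt Q) (n : ℕ) (x : B) :
    (φ ^ n) x - x ^ Nat.card (A ⧸ Q.under A) ^ n ∈ Q := by
  induction n with
  | zero => simp
  | succ n ih =>
    rw [← Ideal.Quotient.eq] at ih ⊢
    rw [pow_succ', AlgHom.mul_apply, h.mk_apply, ih, map_pow, map_pow, ← pow_mul, pow_succ]

theorem isAlgebraic_quotient_under {A B : Type*} [CommRing A] [CommRing B] [Algebra A B]
    [Algebra.IsIntegral A B] (Q : Ideal B) [Q.IsPrime] :
    Algebra.IsAlgebraic (A ⧸ Q.under A) (B ⧸ Q) where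
  isAlgebraic x := by
    obtain ⟨x, rfl⟩ := Ideal.Quotient.mk_surjective x
    have hx := (Algebra.IsIntegral.isIntegral (R := A) x).map (Ideal.Quotient.mkₐ A Q)
    exact (hx.tower_top (A := A ⧸ Q.under A)).isAlgebraic

variable {R K L : Type*} [CommRing R] [Field K] [Algebra R K] [Field L] [Algebra K L] [Algebra R L]
  [IsScalarTower R K L]

variable (R) in
theorem mapIntegralClosure_pow (σ : Gal(L/K)) (n : ℕ) :
    ((σ ^ n).restrictScalars R).mapIntegralClosure.toAlgHom =
      (σ.restrictScalars R).mapIntegralClosure.toAlgHom ^ n := by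
  induction n with
  | zero => rfl
  | succ n ih => rw [pow_succ, pow_succ, ← ih]; rfl

theorem continuous_apply_mapIntegralClosure [Algebra.IsIntegral K L] (x : integralClosure R L)
    {X : Type*} [TopologicalSpace X] (f : integralClosure R L → X) :
    Continuous fun σ : Gal(L/K) => f ((σ.restrictScalars R).mapIntegralClosure x) := by
  refine ((IsLocallyConstant.iff_exists_open _).2 fun σ => ⟨(σ⁻¹ * ·) ⁻¹'
    MulAction.stabilizer Gal(L/K) (x : L), (stabilizer_isOpen_of_isIntegral (K := K)
      (x : L)).preimage (continuous_const_mul σ⁻¹), by simp, fun τ hτ => ?_⟩).continuous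
  have hτx : σ⁻¹ • τ • (x : L) = x := (mul_smul _ _ _).symm.trans hτ
  exact congr_arg f (Subtype.ext (inv_smul_eq_iff.1 hτx))

theorem exists_pow_mapIntegralClosure_sub_mem [IsLocalRing (integralClosure R L)]
    {Q : Ideal (integralClosure R L)} [hQ : Q.IsMaximal] [Finite (R ⧸ Q.under R)] {Φ : Gal(L/K)}
    (hΦ : (Φ.restrictScalars R).mapIntegralClosure.toAlgHom.IsArithFrobAt Q) (σ : Gal(L/K))
    (s : Finset (integralClosure R L)) :
    ∃ n : ℕ, ∀ x ∈ s, ((Φ ^ n).restrictScalars R).mapIntegralClosure x -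
      (σ.restrictScalars R).mapIntegralClosure x ∈ Q := by
  let A := integralClosure R L
  let φ : A ≃ₐ[R] A := (σ.restrictScalars R).mapIntegralClosure
  have hφQ : Q ≤ Q.comap φ := by
    have : (Q.comap φ).IsMaximal := Ideal.comap_isMaximal_of_surjective _ φ.surjective
    exact ((IsLocalRing.eq_maximalIdeal hQ).trans (IsLocalRing.eq_maximalIdeal this).symm).le
  have : (Q.under R).IsMaximal := Ideal.isMaximal_comap_of_isIntegral_of_isMaximal Q
  have : Algebra.IsAlgebraic (R ⧸ Q.under R) (A ⧸ Q) := isAlgebraic_quotient_under Q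
  let _ := Ideal.Quotient.field (Q.under R)
  let _ := Ideal.Quotient.field Q
  let τ : (A ⧸ Q) →ₐ[R ⧸ Q.under R] (A ⧸ Q) :=
    { toRingHom := Ideal.quotientMap Q φ.toAlgHom.toRingHom hφQ
      commutes' := fun x => by
        obtain ⟨x, rfl⟩ := Ideal.Quotient.mk_surjective x
        exact congr_arg (Ideal.Quotient.mk Q) (φ.commutes x) }
  classical
  obtain ⟨n, hn⟩ := exists_algHom_apply_eq_pow_card τ (s.image (Ideal.Quotient.mk Q))
  refine ⟨n, fun x hx => Ideal.Quotient.eq.1 ?_⟩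
  have hΦx := Ideal.Quotient.eq.2 (isArithFrobAt_pow_apply_sub_mem hΦ n x)
  rw [← mapIntegralClosure_pow, map_pow] at hΦx
  exact hΦx.trans (hn _ (Finset.mem_image_of_mem _ hx)).symm

theorem dense_zpowers_of_isArithFrobAt [IsGalois K L] [IsLocalRing (integralClosure R L)]
    {Q : Ideal (integralClosure R L)} [Q.IsMaximal] [Finite (R ⧸ Q.under R)] {Φ : Gal(L/K)}
    (hΦ : (Φ.restrictScalars R).mapIntegralClosure.toAlgHom.IsArithFrobAt Q)
    (hinj : ∀ σ τ : Gal(L/K), (∀ x, (σ.restrictScalars R).mapIntegralClosure x -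
      (τ.restrictScalars R).mapIntegralClosure x ∈ Q) → σ = τ) :
    Dense (Subgroup.zpowers Φ : Set Gal(L/K)) := by
  let A := integralClosure R L
  let _ : TopologicalSpace (A ⧸ Q) := ⊥
  have : DiscreteTopology (A ⧸ Q) := ⟨rfl⟩
  let ρ : Gal(L/K) → A → A ⧸ Q := fun σ x =>
    Ideal.Quotient.mk Q ((σ.restrictScalars R).mapIntegralClosure x)
  have hρ : Continuous ρ := continuous_pi fun x => continuous_apply_mapIntegralClosure x _
  have hemb : IsClosedEmbedding ρ := hρ.isClosedEmbedding fun σ τ h =>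
    hinj σ τ fun x => Ideal.Quotient.eq.1 congr($h x)
  rw [dense_iff_inter_open]
  rintro U hU ⟨σ, hσ⟩
  obtain ⟨V, hV, rfl⟩ := hemb.isOpen_iff.1 hU
  obtain ⟨s, u, hu, hs⟩ := isOpen_pi_iff.1 hV (ρ σ) hσ
  obtain ⟨n, hn⟩ := exists_pow_mapIntegralClosure_sub_mem hΦ σ s
  refine ⟨Φ ^ n, hs fun x hx => ?_, ⟨n, zpow_natCast _ _⟩⟩
  rw [show ρ (Φ ^ n) x = ρ σ x from Ideal.Quotient.eq.2 (hn x hx)]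
  exact (hu x hx).2

variable [IsIntegrallyClosed R] [IsFractionRing R K] [IsGalois K L]

theorem isInvariant_integralClosure [MulSemiringAction Gal(L/K) (integralClosure R L)]
    (hsmul : ∀ (σ : Gal(L/K)) (x : integralClosure R L),
      ((σ • x : integralClosure R L) : L) = σ x) :
    Algebra.IsInvariant R (integralClosure R L) Gal(L/K) where
  isInvariant x hx := by
    obtain ⟨y, hy⟩ := (InfiniteGalois.mem_range_algebraMap_iff_fixed (x : L)).2
      fun σ => (hsmul σ x).symm.trans (congr_arg _ (hx σ))
    have hy_int : IsIntegral R y := by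
      rw [← isIntegral_algebraMap_iff (FaithfulSMul.algebraMap_injective K L), hy]
      exact x.2
    obtain ⟨z, rfl⟩ := IsIntegrallyClosed.algebraMap_eq_of_integral hy_int
    exact ⟨z, Subtype.ext ((IsScalarTower.algebraMap_apply R K L z).trans hy)⟩

theorem exists_isArithFrobAt_mapIntegralClosure (Q : Ideal (integralClosure R L))
    [Q.IsMaximal] [Finite (R ⧸ Q.under R)] :
    ∃ σ : Gal(L/K), (σ.restrictScalars R).mapIntegralClosure.toAlgHom.IsArithFrobAt Q := by
  let A := integralClosure R L
  let _ : MulSemiringAction Gal(L/K) A := IsIntegralClosure.MulSemiringAction R K L A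
  have hsmul (σ : Gal(L/K)) (x : A) : ((σ • x : A) : L) = σ x :=
    algebraMap_galRestrict_apply R σ x
  have hsmul' (σ : Gal(L/K)) (x : A) : σ • x = (σ.restrictScalars R).mapIntegralClosure x :=
    Subtype.ext (hsmul σ x)
  have : SMulCommClass Gal(L/K) R A := ⟨fun σ r x => by
    rw [hsmul', hsmul', map_smul]⟩
  have : Algebra.IsInvariant R A Gal(L/K) := isInvariant_integralClosure hsmul
  let _ : TopologicalSpace A := ⊥
  have : DiscreteTopology A := ⟨rfl⟩
  have : ContinuousSMul Gal(L/K) A := ⟨continuous_prod_of_discrete_right.2 fun x =>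
    (continuous_apply_mapIntegralClosure x id).congr fun σ => (hsmul' σ x).symm⟩
  have : (Q.under R).IsMaximal := Ideal.isMaximal_comap_of_isIntegral_of_isMaximal Q
  have : Algebra.IsAlgebraic (R ⧸ Q.under R) (A ⧸ Q) := isAlgebraic_quotient_under Q
  let _ := Ideal.Quotient.field (Q.under R)
  let _ := Ideal.Quotient.field Q
  have := Fintype.ofFinite (R ⧸ Q.under R)
  obtain ⟨σ, hσ⟩ := Ideal.Quotient.stabilizerHom_surjective_of_profinite (G := Gal(L/K))
    (Q.under R) Q (FiniteField.frobeniusAlgEquivOfAlgebraic (R ⧸ Q.under R) (A ⧸ Q))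
  refine ⟨σ, fun x => Ideal.Quotient.eq.1 ?_⟩
  have hσx := congr($hσ (Ideal.Quotient.mk Q x))
  rw [Ideal.Quotient.stabilizerHom_apply] at hσx
  rw [map_pow, Nat.card_eq_fintype_card]
  exact (congr_arg _ (hsmul' σ.1 x).symm).trans hσx

end Frobenius

/-! ### Extensions generated by roots of unity -/

section RootsOfUnity

open Polynomial

variable {R B : Type*} [CommRing R] [CommRing B] [Algebra R B] {x : B} {N : ℕ}

theorem isUnit_natCast_mul_pow_sub_one (hN : IsUnit (N : R)) (hN₀ : N ≠ 0) (hx : x ^ N = 1) :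
    IsUnit (N * x ^ (N - 1) : B) := by
  refine .mul ?_ ((IsUnit.of_pow_eq_one hx hN₀).pow _)
  simpa only [map_natCast] using hN.map (algebraMap R B)

theorem formallyUnramified_of_adjoin_singleton_eq_top_of_pow_eq_one
    (htop : Algebra.adjoin R {x} = ⊤) (hN : IsUnit (N : R)) (hN₀ : N ≠ 0) (hx : x ^ N = 1) :
    Algebra.FormallyUnramified R B := by
  have hDx : KaehlerDifferential.D R B x = 0 := by
    have hD := congr_arg (KaehlerDifferential.D R B) hx
    rw [Derivation.leibniz_pow, Derivation.map_one_eq_zero, ← Nat.cast_smul_eq_nsmul B,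
      smul_smul] at hD
    exact (isUnit_natCast_mul_pow_sub_one hN hN₀ hx).smul_eq_zero.1 hD
  have hD : KaehlerDifferential.D R B = 0 := Derivation.ext fun y =>
    Derivation.eqOn_adjoin (D2 := (0 : Derivation R B _)) (Set.eqOn_singleton.2 hDx)
      (htop ▸ Algebra.mem_top : y ∈ Algebra.adjoin R {x})
  rw [Algebra.formallyUnramified_iff, ← Submodule.subsingleton_iff B,
    ← subsingleton_iff_bot_eq_top, ← KaehlerDifferential.span_range_derivation, hD, eq_comm,
    Submodule.span_eq_bot]
  rintro _ ⟨y, rfl⟩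
  rfl

theorem isUnit_aeval_derivative_minpoly_of_pow_eq_one [IsDomain R] [IsIntegrallyClosed R]
    [IsDomain B] [Module.IsTorsionFree R B] (hN : IsUnit (N : R)) (hN₀ : N ≠ 0) (hx : x ^ N = 1) :
    IsUnit (aeval x (derivative (minpoly R x))) := by
  have hx_int : IsIntegral R x := ⟨X ^ N - 1, monic_X_pow_sub_C 1 hN₀, by simp [hx]⟩
  obtain ⟨g, hg⟩ := minpoly.isIntegrallyClosed_dvd hx_int (p := X ^ N - 1) (by simp [hx])
  have hder := congr_arg (fun p => aeval x (derivative p)) hg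
  simp only [derivative_mul, map_add, map_mul, minpoly.aeval, zero_mul, add_zero,
    derivative_X_pow, derivative_one, map_sub, sub_zero, map_pow, aeval_X, map_natCast] at hder
  exact isUnit_of_mul_isUnit_left (hder ▸ isUnit_natCast_mul_pow_sub_one hN hN₀ hx)

theorem formallyUnramified_of_pow_eq_one {K L : Type*} [IsDedekindDomain R] [Field K] [Algebra R K]
    [IsFractionRing R K] [Field L] [Algebra K L] [Algebra R L] [IsScalarTower R K L] [Algebra B L]
    [IsScalarTower R B L] [IsIntegralClosure B R L] [FiniteDimensional K L]
    [Algebra.IsSeparable K L] [IsDedekindDomain B] [Module.IsTorsionFree R B]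
    (htop : Algebra.adjoin K {algebraMap B L x} = ⊤) (hN : IsUnit (N : R)) (hN₀ : N ≠ 0)
    (hx : x ^ N = 1) : Algebra.FormallyUnramified R B := by
  have hcond := conductor_mul_differentIdeal R K L x htop
  rw [Ideal.span_singleton_eq_top.2 (isUnit_aeval_derivative_minpoly_of_pow_eq_one hN hN₀ hx)]
    at hcond
  have hcond_top : conductor R x = ⊤ := top_le_iff.1 (hcond ▸ Ideal.mul_le_left)
  exact formallyUnramified_of_adjoin_singleton_eq_top_of_pow_eq_one
    (conductor_eq_top_iff_adjoin_eq_top.1 hcond_top) hN hN₀ hx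

end RootsOfUnity

theorem pow_sub_one_dvd_pow_sub_one_iff {q m n : ℕ} (hq : 2 ≤ q) :
    q ^ m - 1 ∣ q ^ n - 1 ↔ m ∣ n := by
  rw [← Nat.gcd_eq_left_iff_dvd, Nat.pow_sub_one_gcd_pow_sub_one, ← Nat.gcd_eq_left_iff_dvd]
  refine ⟨fun h => Nat.pow_right_injective hq ?_, fun h => by rw [h]⟩
  have hm : 0 < q ^ m := by positivity
  have hgcd : 0 < q ^ m.gcd n := by positivity
  dsimp only
  omega

section ResidueField

variable {R : Type*} [CommRing R] [IsLocalRing R] [Finite (IsLocalRing.ResidueField R)]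

theorem isUnit_natCast_card_residueField_pow_sub_one {m : ℕ} (hm : m ≠ 0) :
    IsUnit ((Nat.card (IsLocalRing.ResidueField R) ^ m - 1 : ℕ) : R) := by
  have hcard : (Nat.card (IsLocalRing.ResidueField R) : IsLocalRing.ResidueField R) = 0 := by
    have := Fintype.ofFinite (IsLocalRing.ResidueField R)
    rw [Nat.card_eq_fintype_card]
    exact FiniteField.cast_card_eq_zero _
  refine (IsLocalRing.residue_ne_zero_iff_isUnit _).1 ?_
  rw [map_natCast, Nat.cast_sub (Nat.one_le_pow _ _ Nat.card_pos), Nat.cast_pow, hcard,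
    zero_pow hm, Nat.cast_one, zero_sub]
  exact neg_ne_zero.2 one_ne_zero

theorem finite_quotient_under {A : Type*} [CommRing A] [Algebra R A] [Algebra.IsIntegral R A]
    (Q : Ideal A) [Q.IsMaximal] : Finite (R ⧸ Q.under R) := by
  have : (Q.under R).IsMaximal := Ideal.isMaximal_comap_of_isIntegral_of_isMaximal Q
  rw [IsLocalRing.eq_maximalIdeal this]
  exact inferInstanceAs (Finite (IsLocalRing.ResidueField R))

end ResidueField

/-! ### The Galois group of the maximal unramified extension -/

section MaximalUnramified

variable {K : Type u} [Field K] [ValuativeRel K] [TopologicalSpace K]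
  [IsNonarchimedeanLocalField K] [CharZero K]
  {Kbar : Type v} [Field Kbar] [Algebra K Kbar] [IsAlgClosure K Kbar]

instance isGalois_maximalUnramified : IsGalois K (maximalUnramified K Kbar) where

omit [TopologicalSpace K] [IsNonarchimedeanLocalField K] [CharZero K] [IsAlgClosure K Kbar] in
theorem IsFiniteUnramified.le_maximalUnramified {E : IntermediateField K Kbar}
    (hE : IsFiniteUnramified K Kbar E) : E ≤ maximalUnramified K Kbar :=
  le_iSup (fun E : {E : IntermediateField K Kbar // IsFiniteUnramified K Kbar E} => E.1) ⟨E, hE⟩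

theorem IsFiniteUnramified.algHom_ext_of_sub_mem {E : IntermediateField K Kbar}
    (hE : IsFiniteUnramified K Kbar E) {L : Type*} [Field L] [Algebra K L]
    {Q : Ideal (integralClosure 𝒪[K] L)} (hQ : Q ≠ ⊤) {f g : E →ₐ[K] L}
    (h : ∀ b, (f.restrictScalars 𝒪[K]).mapIntegralClosure b -
      (g.restrictScalars 𝒪[K]).mapIntegralClosure b ∈ Q) : f = g := by
  obtain ⟨_, _⟩ := hE
  have : Module.Finite 𝒪[K] (integralClosure 𝒪[K] E) :=
    IsIntegralClosure.finite 𝒪[K] K E (integralClosure 𝒪[K] E)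
  have := IsIntegralClosure.isFractionRing_of_finite_extension 𝒪[K] K E (integralClosure 𝒪[K] E)
  have hfg := algHom_ext_of_formallyUnramified hQ h
  have hfg_coe (a : integralClosure 𝒪[K] E) : f (a : E) = g (a : E) :=
    congr_arg Subtype.val congr($hfg a)
  ext x
  obtain ⟨a, b, -, rfl⟩ := IsFractionRing.div_surjective (A := integralClosure 𝒪[K] E) x
  rw [map_div₀, map_div₀]
  exact congr_arg₂ _ (hfg_coe a) (hfg_coe b)

theorem maximalUnramified_algEquiv_ext_of_sub_mem
    {Q : Ideal (integralClosure 𝒪[K] (maximalUnramified K Kbar))} (hQ : Q ≠ ⊤)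
    {σ τ : Gal(maximalUnramified K Kbar/K)}
    (h : ∀ x, (σ.restrictScalars 𝒪[K]).mapIntegralClosure x -
      (τ.restrictScalars 𝒪[K]).mapIntegralClosure x ∈ Q) : σ = τ := by
  let D : IntermediateField K (maximalUnramified K Kbar) :=
    (AlgHom.equalizer σ.toAlgHom τ.toAlgHom).toIntermediateField fun x hx => by
      rw [AlgHom.mem_equalizer] at hx ⊢
      rw [map_inv₀, map_inv₀, hx]
  have hD : maximalUnramified K Kbar ≤ IntermediateField.lift D := by
    refine iSup_le fun E x hx => ?_
    let ι := IntermediateField.inclusion E.2.le_maximalUnramified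
    have hστ : σ.toAlgHom.comp ι = τ.toAlgHom.comp ι := E.2.algHom_ext_of_sub_mem hQ
      fun b => h ((ι.restrictScalars 𝒪[K]).mapIntegralClosure b)
    exact (IntermediateField.mem_lift (ι ⟨x, hx⟩)).2 congr($hστ ⟨x, hx⟩)
  ext x
  exact congr_arg Subtype.val ((IntermediateField.mem_lift x).1 (hD x.2))

theorem exists_isUnramifiedFrobenius :
    ∃ Φ : Gal(maximalUnramified K Kbar/K), IsUnramifiedFrobenius Φ := by
  let Q := IsLocalRing.maximalIdeal (integralClosure 𝒪[K] (maximalUnramified K Kbar))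
  have : Finite (𝒪[K] ⧸ Q.under 𝒪[K]) := finite_quotient_under Q
  obtain ⟨Φ, hΦ⟩ := exists_isArithFrobAt_mapIntegralClosure (K := K) Q
  exact ⟨Φ, fun Q' hQ' => by rwa [IsLocalRing.eq_maximalIdeal hQ']⟩

theorem isFiniteUnramified_adjoin_of_pow_eq_one {ζ : Kbar} {N : ℕ} (hN : IsUnit (N : 𝒪[K]))
    (hN₀ : N ≠ 0) (hζ : ζ ^ N = 1) :
    IsFiniteUnramified K Kbar (IntermediateField.adjoin K {ζ}) := by
  have hζ_int : IsIntegral K ζ := Algebra.IsIntegral.isIntegral ζ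
  have := IntermediateField.adjoin.finiteDimensional hζ_int
  refine ⟨this, ?_⟩
  let E := IntermediateField.adjoin K {ζ}
  let z : E := IntermediateField.AdjoinSimple.gen K ζ
  have hz : z ^ N = 1 := Subtype.ext hζ
  have hz_int : IsIntegral 𝒪[K] z :=
    IsIntegral.of_pow (Nat.pos_of_ne_zero hN₀) (hz ▸ isIntegral_one)
  have := IsIntegralClosure.isDedekindDomain 𝒪[K] K E (integralClosure 𝒪[K] E)
  have : Module.IsTorsionFree 𝒪[K] (integralClosure 𝒪[K] E) :=
    Module.isTorsionFree_iff_faithfulSMul.2 <| (faithfulSMul_iff_algebraMap_injective _ _).2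
      fun a b h => Subtype.ext ((algebraMap K E).injective congr($h.1))
  exact formallyUnramified_of_pow_eq_one (K := K) (L := E) (x := ⟨z, hz_int⟩)
    (IntermediateField.adjoin.powerBasis hζ_int).adjoin_gen_eq_top hN hN₀ (Subtype.ext hz)

theorem exists_isPrimitiveRoot_maximalUnramified {N : ℕ} (hN : IsUnit (N : 𝒪[K])) (hN₀ : N ≠ 0) :
    ∃ z : maximalUnramified K Kbar, IsPrimitiveRoot z N := by
  have : IsAlgClosed Kbar := IsAlgClosure.isAlgClosed K
  have : CharZero Kbar := charZero_of_injective_algebraMap (algebraMap K Kbar).injective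
  have : NeZero (N : Kbar) := ⟨Nat.cast_ne_zero.2 hN₀⟩
  obtain ⟨ζ, hζ⟩ := HasEnoughRootsOfUnity.exists_primitiveRoot Kbar N
  have hζ_mem : ζ ∈ maximalUnramified K Kbar :=
    (isFiniteUnramified_adjoin_of_pow_eq_one hN hN₀ hζ.pow_eq_one).le_maximalUnramified
      (IntermediateField.mem_adjoin_simple_self K ζ)
  exact ⟨⟨ζ, hζ_mem⟩, IsPrimitiveRoot.of_map_of_injective
    (f := (maximalUnramified K Kbar).val) hζ (RingHom.injective _)⟩

namespace IsUnramifiedFrobenius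

variable {Φ Ψ : Gal(maximalUnramified K Kbar/K)}

theorem unique (hΦ : IsUnramifiedFrobenius Φ) (hΨ : IsUnramifiedFrobenius Ψ) : Φ = Ψ := by
  let Q := IsLocalRing.maximalIdeal (integralClosure 𝒪[K] (maximalUnramified K Kbar))
  refine maximalUnramified_algEquiv_ext_of_sub_mem (Ideal.IsMaximal.ne_top inferInstance : Q ≠ ⊤)
    fun x => ?_
  rw [← sub_sub_sub_cancel_right]
  exact Q.sub_mem (hΦ Q inferInstance x) (hΨ Q inferInstance x)

theorem frobeniusPowers_eq (hΦ : IsUnramifiedFrobenius Φ) :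
    frobeniusPowers K Kbar = Subgroup.zpowers Φ := by
  rw [frobeniusPowers, Subgroup.zpowers_eq_closure]
  congr 1
  ext Ψ
  exact ⟨fun h => h.unique hΦ, fun h => (Set.mem_singleton_iff.1 h) ▸ hΦ⟩

theorem dense_zpowers (hΦ : IsUnramifiedFrobenius Φ) :
    Dense (Subgroup.zpowers Φ : Set Gal(maximalUnramified K Kbar/K)) := by
  let Q := IsLocalRing.maximalIdeal (integralClosure 𝒪[K] (maximalUnramified K Kbar))
  have : Finite (𝒪[K] ⧸ Q.under 𝒪[K]) := finite_quotient_under Q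
  exact dense_zpowers_of_isArithFrobAt (hΦ Q inferInstance) fun _ _ =>
    maximalUnramified_algEquiv_ext_of_sub_mem (Ideal.IsMaximal.ne_top inferInstance)

omit [CharZero K] in
theorem apply_of_pow_eq_one (hΦ : IsUnramifiedFrobenius Φ) {z : maximalUnramified K Kbar} {N : ℕ}
    (hN : IsUnit (N : 𝒪[K])) (hN₀ : N ≠ 0) (hz : z ^ N = 1) : Φ z = z ^ Nat.card 𝓀[K] := by
  let A := integralClosure 𝒪[K] (maximalUnramified K Kbar)
  let Q := IsLocalRing.maximalIdeal A
  have hz_int : IsIntegral 𝒪[K] z :=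
    IsIntegral.of_pow (Nat.pos_of_ne_zero hN₀) (hz ▸ isIntegral_one)
  have hNQ : (N : A) ∉ Q := fun h => (IsLocalRing.mem_maximalIdeal _).1 h
    (by simpa only [map_natCast] using hN.map (algebraMap 𝒪[K] A))
  have hQ : Q.under 𝒪[K] = IsLocalRing.maximalIdeal 𝒪[K] :=
    IsLocalRing.eq_maximalIdeal (Ideal.isMaximal_comap_of_isIntegral_of_isMaximal Q)
  have hΦz := (hΦ Q inferInstance).apply_of_pow_eq_one (ζ := ⟨z, hz_int⟩) (Subtype.ext hz) hNQ
  rw [hQ] at hΦz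
  exact congr_arg Subtype.val hΦz

omit [CharZero K] in
theorem pow_apply_of_pow_eq_one (hΦ : IsUnramifiedFrobenius Φ) {z : maximalUnramified K Kbar}
    {N : ℕ} (hN : IsUnit (N : 𝒪[K])) (hN₀ : N ≠ 0) (hz : z ^ N = 1) (n : ℕ) :
    (Φ ^ n) z = z ^ Nat.card 𝓀[K] ^ n := by
  induction n with
  | zero => rw [pow_zero, pow_zero, pow_one, AlgEquiv.one_apply]
  | succ n ih =>
    rw [pow_succ, AlgEquiv.mul_apply, hΦ.apply_of_pow_eq_one hN hN₀ hz, map_pow, ih, ← pow_mul,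
      pow_succ]

theorem isFreeTopologicalGenerator (hΦ : IsUnramifiedFrobenius Φ) :
    IsFreeTopologicalGenerator Φ := by
  refine ⟨hΦ.dense_zpowers, fun m hm => ?_⟩
  -- For `q = #𝓀[K]`, the power `Φ ^ k` fixes the roots of unity of order `q ^ m - 1` iff `m ∣ k`.
  have hq : 2 ≤ Nat.card 𝓀[K] := Finite.one_lt_card
  have hunit : IsUnit ((Nat.card 𝓀[K] ^ m - 1 : ℕ) : 𝒪[K]) :=
    isUnit_natCast_card_residueField_pow_sub_one hm
  have hne : Nat.card 𝓀[K] ^ m - 1 ≠ 0 := by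
    have := Nat.one_lt_pow hm hq
    omega
  obtain ⟨z, hz⟩ := exists_isPrimitiveRoot_maximalUnramified (Kbar := Kbar) hunit hne
  have hstab (n : ℕ) :
      Φ ^ n ∈ MulAction.stabilizer Gal(maximalUnramified K Kbar/K) z ↔ m ∣ n := by
    have hn : Nat.card 𝓀[K] ^ n = (Nat.card 𝓀[K] ^ n - 1) + 1 :=
      (Nat.sub_add_cancel (Nat.one_le_pow n _ Nat.card_pos)).symm
    rw [MulAction.mem_stabilizer_iff, AlgEquiv.smul_def,
      hΦ.pow_apply_of_pow_eq_one hunit hne hz.pow_eq_one, ← pow_sub_one_dvd_pow_sub_one_iff hq,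
      ← hz.pow_eq_one_iff_dvd, hn, pow_succ, Nat.add_sub_cancel]
    exact mul_eq_right₀ (hz.ne_zero hne)
  refine ⟨MulAction.stabilizer _ z, stabilizer_isOpen_of_isIntegral z, fun k => ?_⟩
  obtain ⟨n, rfl | rfl⟩ := k.eq_nat_or_neg
  · rw [zpow_natCast, hstab, Int.natCast_dvd_natCast]
  · rw [zpow_neg, inv_mem_iff, zpow_natCast, hstab, dvd_neg, Int.natCast_dvd_natCast]

end IsUnramifiedFrobenius

end MaximalUnramified

/-! ### The Weil group as a group with degree datum -/

section LocalField

variable (K : Type u) [Field K] [ValuativeRel K] (Kbar : Type v) [Field Kbar] [Algebra K Kbar]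
  [IsAlgClosure K Kbar]

theorem WeilGroup.isOpen_inertia :
    IsOpen {w : WeilGroup K Kbar | galToUnramified K Kbar (toGal K Kbar w) = 1} := by
  let _ : TopologicalSpace (frobeniusPowers K Kbar) := ⊥
  have hcont : Continuous (toFrobeniusPowers K Kbar) := continuous_iff_le_induced.2 inf_le_right
  have hker : {w : WeilGroup K Kbar | galToUnramified K Kbar (toGal K Kbar w) = 1} =
      toFrobeniusPowers K Kbar ⁻¹' {1} := Set.ext fun w => Subtype.mk_eq_mk.symm
  rw [hker]
  exact IsOpen.preimage hcont trivial

theorem WeilGroup.isInducing_inertia_toGal :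
    IsInducing fun w : {w : WeilGroup K Kbar // galToUnramified K Kbar (toGal K Kbar w) = 1} =>
      toGal K Kbar w := by
  let _ : TopologicalSpace (frobeniusPowers K Kbar) := ⊥
  constructor
  have hconst : toFrobeniusPowers K Kbar ∘ (Subtype.val : {w : WeilGroup K Kbar //
      galToUnramified K Kbar (toGal K Kbar w) = 1} → WeilGroup K Kbar) = fun _ => 1 :=
    funext fun w => Subtype.ext w.2
  change TopologicalSpace.induced _ (_ ⊓ _) = _
  rw [induced_inf, induced_compose, induced_compose, hconst, induced_const, inf_top_eq]
  rfl

variable [TopologicalSpace K] [IsNonarchimedeanLocalField K] [CharZero K]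

theorem exists_degreeDatum_toGalCont :
    ∃ D : DegreeDatum Gal(Kbar/K) (WeilGroup K Kbar), D.toGroup = WeilGroup.toGalCont K Kbar := by
  have : Normal K Kbar := IsAlgClosure.normal K Kbar
  have : IsGalois K Kbar := { }
  obtain ⟨Φ, hΦ⟩ := exists_isUnramifiedFrobenius (K := K) (Kbar := Kbar)
  refine exists_degreeDatum
    (pr := ⟨galToUnramified K Kbar, InfiniteGalois.restrictNormalHom_continuous _⟩)
    (AlgEquiv.restrictNormalHom_surjective Kbar) hΦ.isFreeTopologicalGenerator
    (WeilGroup.toGalCont K Kbar) Subtype.val_injective ?_ (WeilGroup.isOpen_inertia K Kbar)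
    (WeilGroup.isInducing_inertia_toGal K Kbar)
  rw [← hΦ.frobeniusPowers_eq]
  exact Subtype.range_coe

end LocalField

end

theorem mainTheorem5 (K : Type u) [Field K] [ValuativeRel K] [TopologicalSpace K]
    [IsNonarchimedeanLocalField K] [CharZero K]
    (Kbar : Type v) [Field Kbar] [Algebra K Kbar] [IsAlgClosure K Kbar] :
    -- the restriction homomorphisms are functorial in the module
    (∀ (n : ℕ) (M N : TopRep.{max v w} ℤ Gal(Kbar/K)) (f : M ⟶ N),
      IsDiscreteModule.{v, w} M → IsDiscreteModule.{v, w} N → ∀ x : Coh.{v, w} n M,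
        galoisToWeil.{u, v, w} K Kbar n N (Coh.map.{v, w} n f x) =
          Coh.map.{v, w} n ((weilRes.{u, v, w} K Kbar).map f)
            (galoisToWeil.{u, v, w} K Kbar n M x)) ∧
    -- `H^0(G, M) = H^0(W, M)`
    (∀ M : TopRep.{max v w} ℤ Gal(Kbar/K), IsDiscreteModule.{v, w} M →
      Function.Bijective (galoisToWeil.{u, v, w} K Kbar 0 M)) ∧
    -- `H^1(G, M) = H^1(W, M)_tors`
    (∀ M : TopRep.{max v w} ℤ Gal(Kbar/K), IsDiscreteModule.{v, w} M →
      Function.Injective (galoisToWeil.{u, v, w} K Kbar 1 M) ∧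
      (galoisToWeil.{u, v, w} K Kbar 1 M).range =
        AddCommGroup.torsion (Coh.{v, w} 1 ((weilRes.{u, v, w} K Kbar).obj M))) ∧
    -- functorial exact sequence `0 → H^1(W, M) ⊗ ℚ/ℤ → H^2(G, M) → H^2(W, M) → 0`
    (∃ δ : ∀ M : TopRep.{max v w} ℤ Gal(Kbar/K), IsDiscreteModule.{v, w} M →
        (Coh.{v, w} 1 ((weilRes.{u, v, w} K Kbar).obj M) ⊗[ℤ] AddCircle (1 : ℚ) →+
          Coh.{v, w} 2 M),
      (∀ (M N : TopRep.{max v w} ℤ Gal(Kbar/K)) (f : M ⟶ N)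
        (hM : IsDiscreteModule.{v, w} M) (hN : IsDiscreteModule.{v, w} N)
        (x : Coh.{v, w} 1 ((weilRes.{u, v, w} K Kbar).obj M) ⊗[ℤ] AddCircle (1 : ℚ)),
          Coh.map.{v, w} 2 f (δ M hM x) =
            δ N hN ((Coh.map.{v, w} 1
              ((weilRes.{u, v, w} K Kbar).map f)).toIntLinearMap.rTensor _ x)) ∧
      ∀ (M : TopRep.{max v w} ℤ Gal(Kbar/K)) (hM : IsDiscreteModule.{v, w} M),
        Function.Injective (δ M hM) ∧
        Function.Exact (δ M hM) (galoisToWeil.{u, v, w} K Kbar 2 M) ∧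
        Function.Surjective (galoisToWeil.{u, v, w} K Kbar 2 M)) ∧
    -- `H^i(G, M) = H^i(W, M)` for `i ≥ 3`
    (∀ M : TopRep.{max v w} ℤ Gal(Kbar/K), IsDiscreteModule.{v, w} M → ∀ i : ℕ, 3 ≤ i →
      Function.Bijective (galoisToWeil.{u, v, w} K Kbar i M)) := by
  have : Normal K Kbar := IsAlgClosure.normal K Kbar
  have : IsGalois K Kbar := { }
  obtain ⟨D, hD⟩ := exists_degreeDatum_toGalCont K Kbar
  have := D.locallyCompactSpace
  unfold galoisToWeil weilRes
  generalize WeilGroup.toGalCont K Kbar = φ at hD ⊢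
  subst hD
  refine ⟨fun n M N f _ _ x => Coh.res_map D.toGroup f n x, fun M hM => D.bijective_res_zero hM,
    fun M hM => ⟨D.injective_res_one hM, ?_⟩,
    ⟨fun M hM => D.tensorδ hM, fun M N f hM hN x => D.map_tensorδ hM hN f x,
      fun M hM => ⟨D.injective_tensorδ hM, D.exact_tensorδ_res hM, D.surjective_res_two hM⟩⟩,
    fun M hM i hi => ?_⟩
  · ext y
    exact D.mem_range_res_one_iff hM y
  · obtain ⟨n, rfl⟩ := Nat.exists_eq_add_of_le' hi
    exact D.bijective_res_add_three hM n
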